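/- \textbf{Conventions.} Directed and codirected sets are non-empty. In a poset, $x\ll y$ means that for every directed $D$ having a supremum with $y\le\sup D$ there is $d\in D$ with $x\le d$. A \emph{stably continuous lattice} is a complete lattice $L$ such that for every $x$ the set $\{y\mid y\ll x\}$ is directed with supremum $x$, $\top\ll\top$, and $x\ll y$, $x\ll z$ imply $x\ll y\wedge z$. A \emph{filter} on $L$ is a non-empty, codirected, upwards closed subset (possibly all of $L$); it is \emph{Scott-open} if it meets every directed $D$ whose supremum belongs to it. $\mathrm{Filt}(L)$ and $\sigma\mathrm{Filt}(L)$ denote the posets of filters and of Scott-open filters on $L$, ordered by inclusion; for $L$ stably continuous, $\sigma\mathrm{Filt}(L)$ is a complete lattice. Let $P$ be a complete lattice and $\mathbf{C}$ a category. Consider the following conditions on a functor $F\colon P^{\mathrm{op}}\to\mathbf{C}$: (1) $F(\bot)$ is subterminal; (2) for all $p,q\in P$ the square formed by $F(p\vee q)$, $F(p)$, $F(q)$, $F(p\wedge q)$ and the restriction maps is a pullback; (3$_{\mathcal K}$) for every codirected $D\subseteq P$, the cocone $(F(p)\to F(\inf D))_{p\in D}$ is a colimit of the restriction of $F$ to $D$;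 (3$_\Omega$) for every directed $D\subseteq P$, the cone $(F(\sup D)\to F(p))_{p\in D}$ is a limit of the restriction of $F$ to $D$. A \emph{$\mathbf{C}$-valued $\mathcal K$-sheaf over $P$} is an $F$ satisfying (1), (2), (3$_{\mathcal K}$); a \emph{$\mathbf{C}$-valued $\Omega$-sheaf over $P$} is an $F$ satisfying (1), (2), (3$_\Omega$). They form full subcategories $\mathcal{K}\mathrm{Sh}(P,\mathbf{C})$ and $\Omega\mathrm{Sh}(P,\mathbf{C})$ of $[P^{\mathrm{op}},\mathbf{C}]$. \textbf{Theorem.} Let $\mathbf{C}$ be a regular category with all small limits and colimits, in which colimits indexed by small directed posets commute with finite limits, and let $L$ be a (small) stably continuous lattice. Let $\mathcal F\subseteq\mathrm{Filt}(L)$ be the sub-poset of all filters that are principal or Scott-open, let $\lambda\colon L^{\mathrm{op}}\to\mathcal F$ be $x\mapsto\{y\mid x\le y\}$, and let $\kappa\colon\sigma\mathrm{Filt}(L)\to\mathcal F$ be the inclusion; write $\lambda^*,\kappa^*$ for precomposition with $\lambda,\kappa$. Then there is an equivalence of categories $$\mathcal{K}\mathrm{Sh}(\sigma\mathrm{Filt}(L)^{\mathrm{op}},\mathbf{C})\;\simeq\;\Omega\mathrm{Sh}(L,\mathbf{C})$$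 whose functor from left to right is, up to natural isomorphism, the restriction of $\lambda^*\circ\mathrm{Ran}_\kappa\colon[\sigma\mathrm{Filt}(L),\mathbf{C}]\to[L^{\mathrm{op}},\mathbf{C}]$, and whose quasi-inverse is, up to natural isomorphism, the restriction of $\kappa^*\circ\mathrm{Lan}_\lambda\colon[L^{\mathrm{op}},\mathbf{C}]\to[\sigma\mathrm{Filt}(L),\mathbf{C}]$. -/

import Mathlib

open CategoryTheory CategoryTheory.Limits Opposite

universe w v u

/-! ### Stably continuous lattices -/

/-- The way-below relation `x ≪ y` of a poset. Directed sets are non-empty. -/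
def WayBelow {P : Type w} [PartialOrder P] (x y : P) : Prop :=
  ∀ D : Set P, D.Nonempty → DirectedOn (· ≤ ·) D → ∀ s : P, IsLUB D s → y ≤ s →
    ∃ d ∈ D, x ≤ d

/-- A poset is continuous if, for every `x`, the set of all `y ≪ x` is directed with supremum
`x`. -/
class IsContinuousPoset (P : Type w) [PartialOrder P] : Prop where
  nonempty_wayBelow : ∀ x : P, {y : P | WayBelow y x}.Nonempty
  directedOn_wayBelow : ∀ x : P, DirectedOn (· ≤ ·) {y : P | WayBelow y x}
  isLUB_wayBelow : ∀ x : P, IsLUB {y : P | WayBelow y x} x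

/-- A stably continuous lattice: a complete lattice that is continuous and whose way-below
relation is multiplicative. -/
class IsStablyContinuousLattice (L : Type w) [CompleteLattice L] : Prop
    extends IsContinuousPoset L where
  top_wayBelow_top : WayBelow (⊤ : L) ⊤
  wayBelow_inf : ∀ x y z : L, WayBelow x y → WayBelow x z → WayBelow x (y ⊓ z)

/-! ### Scott-open filters -/

/-- A Scott-open filter: a filter (non-empty, codirected, upwards closed; possibly improper) that
meets every directed set whose supremum belongs to it. -/
structure ScottOpenFilter (P : Type w) [PartialOrder P] extends Order.PFilter P where
  scottOpen : DirSupInacc (toPFilter : Set P)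

namespace ScottOpenFilter

theorem toPFilter_injective (P : Type w) [PartialOrder P] :
    Function.Injective (toPFilter : ScottOpenFilter P → Order.PFilter P) := by
  rintro ⟨k, hk⟩ ⟨l, hl⟩ h
  cases h
  rfl

/-- Scott-open filters are ordered by inclusion. -/
instance (P : Type w) [PartialOrder P] : PartialOrder (ScottOpenFilter P) :=
  PartialOrder.lift toPFilter (toPFilter_injective P)

variable {L : Type w} [CompleteLattice L]

theorem finset_inf_mem (k : Order.PFilter L) (t : Finset L) (h : ∀ a ∈ t, a ∈ k) :
    t.inf id ∈ k := by
  classical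
  induction t using Finset.induction_on with
  | empty => simp
  | insert a t _ ih =>
    rw [Finset.inf_insert]
    exact Order.PFilter.inf_mem (h a (by simp)) (ih fun b hb => h b (by simp [hb]))

theorem wayBelow_finset_inf [IsStablyContinuousLattice L] (x : L) (t : Finset L)
    (h : ∀ a ∈ t, WayBelow x a) : WayBelow x (t.inf id) := by
  classical
  induction t using Finset.induction_on with
  | empty =>
    intro D h1 h2 s h3 h4
    obtain ⟨d, hd, hd'⟩ := IsStablyContinuousLattice.top_wayBelow_top D h1 h2 s h3 h4
    exact ⟨d, hd, le_top.trans hd'⟩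
  | insert a t _ ih =>
    rw [Finset.inf_insert]
    exact IsStablyContinuousLattice.wayBelow_inf _ _ _ (h a (by simp))
      (ih fun b hb => h b (by simp [hb]))

/-- The filter generated by the union of a set of Scott-open filters. -/
def generate (S : Set (ScottOpenFilter L)) : Order.PFilter L :=
  Order.IsPFilter.toPFilter
    (F := {x | ∃ t : Finset L, (∀ a ∈ t, ∃ k ∈ S, a ∈ k.toPFilter) ∧ t.inf id ≤ x})
    (Order.IsPFilter.of_def ⟨⊤, ∅, by simp, le_top⟩
      (by
        classical
        rintro x ⟨t, ht, hx⟩ y ⟨r, hr, hy⟩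
        refine ⟨(t ∪ r).inf id, ⟨t ∪ r, ?_, le_rfl⟩, ?_, ?_⟩
        · intro a ha
          rcases Finset.mem_union.1 ha with h | h
          exacts [ht a h, hr a h]
        · exact (Finset.inf_mono Finset.subset_union_left).trans hx
        · exact (Finset.inf_mono Finset.subset_union_right).trans hy)
      (by
        rintro x y hxy ⟨t, ht, hx⟩
        exact ⟨t, ht, hx.trans hxy⟩))

theorem mem_generate (S : Set (ScottOpenFilter L)) (x : L) :
    x ∈ generate S ↔
      ∃ t : Finset L, (∀ a ∈ t, ∃ k ∈ S, a ∈ k.toPFilter) ∧ t.inf id ≤ x :=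
  Iff.rfl

theorem scottOpen_generate [IsStablyContinuousLattice L] (S : Set (ScottOpenFilter L)) :
    DirSupInacc (generate S : Set L) := by
  classical
  rintro D h1 h2 s h3 ⟨t, ht, hs⟩
  have key : ∀ a : L, ∃ b : L, a ∈ t → WayBelow b a ∧ ∃ k ∈ S, b ∈ k.toPFilter := by
    intro a
    by_cases ha : a ∈ t
    · obtain ⟨k, hk, hak⟩ := ht a ha
      obtain ⟨b, hb, hbk⟩ := k.scottOpen (IsContinuousPoset.nonempty_wayBelow a)
        (IsContinuousPoset.directedOn_wayBelow a) (IsContinuousPoset.isLUB_wayBelow a) hak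
      exact ⟨b, fun _ => ⟨hb, k, hk, hbk⟩⟩
    · exact ⟨a, fun h => absurd h ha⟩
  choose f hf using key
  have hw : WayBelow ((t.image f).inf id) (t.inf id) := by
    refine wayBelow_finset_inf _ _ fun a ha => ?_
    intro D h1 h2 s h3 h4
    obtain ⟨d, hd, hd'⟩ := (hf a ha).1 D h1 h2 s h3 h4
    exact ⟨d, hd, (Finset.inf_le (f := id) (Finset.mem_image_of_mem f ha)).trans hd'⟩
  obtain ⟨d, hd, hd'⟩ := hw D h1 h2 s h3 hs
  refine ⟨d, hd, t.image f, ?_, hd'⟩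
  intro b hb
  obtain ⟨a, ha, rfl⟩ := Finset.mem_image.1 hb
  exact (hf a ha).2

instance [IsStablyContinuousLattice L] : SupSet (ScottOpenFilter L) :=
  ⟨fun S => ⟨generate S, scottOpen_generate S⟩⟩

theorem isLUB_sSup [IsStablyContinuousLattice L] (S : Set (ScottOpenFilter L)) :
    IsLUB S (sSup S) := by
  constructor
  · intro k hk x hx
    exact ⟨{x}, fun a ha => ⟨k, hk, by rw [Finset.mem_singleton.1 ha]; exact hx⟩, by simp⟩
  · rintro l hl x ⟨t, ht, hx⟩
    refine Order.PFilter.mem_of_le hx (finset_inf_mem _ t fun a ha => ?_)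
    obtain ⟨k, hk, hak⟩ := ht a ha
    exact hl hk hak

/-- The Scott-open filters on a stably continuous lattice form a complete lattice (with respect to
inclusion). -/
instance [IsStablyContinuousLattice L] : CompleteLattice (ScottOpenFilter L) :=
  completeLatticeOfSup _ isLUB_sSup

end ScottOpenFilter

/-! ### Sheaves on a complete lattice -/

section Sheaves

variable {P : Type w} [CompleteLattice P] {C : Type u} [Category.{v} C]

/-- The restriction of a presheaf `F` on `P` to a subset `D` of `P`. -/
def restrictToSubset (F : Pᵒᵖ ⥤ C) (D : Set P) : (↥D)ᵒᵖ ⥤ C :=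
  (Subtype.mono_coe (· ∈ D)).functor.op ⋙ F

/-- The cone `(F (sup D) ⟶ F p)`, `p ∈ D`. -/
def supCone (F : Pᵒᵖ ⥤ C) (D : Set P) : Cone (restrictToSubset F D) where
  pt := F.obj (op (sSup D))
  π :=
    { app := fun p => F.map (homOfLE (le_sSup p.unop.2)).op
      naturality := fun p _ f =>
        (Category.id_comp _).trans (F.map_comp (homOfLE (le_sSup p.unop.2)).op
          ((Subtype.mono_coe (· ∈ D)).functor.op.map f)) }

/-- The cocone `(F p ⟶ F (inf D))`, `p ∈ D`. -/
def infCocone (F : Pᵒᵖ ⥤ C) (D : Set P) : Cocone (restrictToSubset F D) where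
  pt := F.obj (op (sInf D))
  ι :=
    { app := fun p => F.map (homOfLE (sInf_le p.unop.2)).op
      naturality := fun _ q f =>
        (F.map_comp ((Subtype.mono_coe (· ∈ D)).functor.op.map f)
          (homOfLE (sInf_le q.unop.2)).op).symm.trans (Category.comp_id _).symm }

/-- For all `p` and `q`, the square `F (p ⊔ q)`, `F p`, `F q`, `F (p ⊓ q)` is a pullback. -/
def SupInfPullback (F : Pᵒᵖ ⥤ C) : Prop :=
  ∀ p q : P, IsPullback
    (F.map (homOfLE (le_sup_left : p ≤ p ⊔ q)).op)
    (F.map (homOfLE (le_sup_right : q ≤ p ⊔ q)).op)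
    (F.map (homOfLE (inf_le_left : p ⊓ q ≤ p)).op)
    (F.map (homOfLE (inf_le_right : p ⊓ q ≤ q)).op)

/-- `𝒦`-sheaves: presheaves with `F ⊥` subterminal, satisfying the pullback condition, and such
that for every codirected `D` the object `F (inf D)` is the colimit of the restriction of `F`
to `D`. -/
structure IsKSheaf (F : Pᵒᵖ ⥤ C) : Prop where
  subterminal : IsSubterminal (F.obj (op ⊥))
  pullback : SupInfPullback F
  colimit : ∀ D : Set P, D.Nonempty → DirectedOn (· ≥ ·) D → Nonempty (IsColimit (infCocone F D))

/-- `Ω`-sheaves: presheaves with `F ⊥` subterminal, satisfying the pullback condition, and such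
that for every directed `D` the object `F (sup D)` is the limit of the restriction of `F`
to `D`. -/
structure IsOmegaSheaf (F : Pᵒᵖ ⥤ C) : Prop where
  subterminal : IsSubterminal (F.obj (op ⊥))
  pullback : SupInfPullback F
  limit : ∀ D : Set P, D.Nonempty → DirectedOn (· ≤ ·) D → Nonempty (IsLimit (supCone F D))

variable (P C)

/-- `𝒦`-sheaves as a property of presheaves. -/
def kSheafProperty : ObjectProperty (Pᵒᵖ ⥤ C) := fun F => IsKSheaf F

/-- `Ω`-sheaves as a property of presheaves. -/
def omegaSheafProperty : ObjectProperty (Pᵒᵖ ⥤ C) := fun F => IsOmegaSheaf F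

/-- The category of `C`-valued `𝒦`-sheaves over `P`, a full subcategory of the presheaves. -/
abbrev KSh := (kSheafProperty P C).FullSubcategory

/-- The category of `C`-valued `Ω`-sheaves over `P`, a full subcategory of the presheaves. -/
abbrev OmegaSh := (omegaSheafProperty P C).FullSubcategory

end Sheaves

/-! ### The Kan extensions -/

section Kan

variable (L : Type w) [PartialOrder L]

/-- The poset, ordered by inclusion, of all filters on `L` that are principal or Scott-open. -/
abbrev PrincipalOrScottOpenFilter : Type w :=
  {φ : Order.PFilter L // (∃ x : L, φ = Order.PFilter.principal x) ∨ DirSupInacc (φ : Set L)}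

/-- `λ`, which sends `x` to the principal filter of all elements above `x`. -/
def lambdaFunctor : Lᵒᵖ ⥤ PrincipalOrScottOpenFilter L where
  obj x := ⟨Order.PFilter.principal x.unop, Or.inl ⟨x.unop, rfl⟩⟩
  map f := homOfLE (Order.PFilter.antitone_principal (leOfHom f.unop))

/-- `κ`, the inclusion of the Scott-open filters. Its domain is the poset of Scott-open filters,
written as the opposite category of the order dual of that poset, so that a functor out of it is
a presheaf on the order dual. -/
def kappaFunctor : ((ScottOpenFilter L)ᵒᵈ)ᵒᵖ ⥤ PrincipalOrScottOpenFilter L where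
  obj k := ⟨(OrderDual.ofDual k.unop).toPFilter, Or.inr (OrderDual.ofDual k.unop).scottOpen⟩
  map f := homOfLE (leOfHom f.unop)

variable (C : Type u) [Category.{v} C]

/-- `λ^* Ran_κ`: right Kan extension along `κ`, followed by restriction along `λ`. -/
noncomputable def lambdaRanKappa [HasLimitsOfSize.{w, w} C] :
    (((ScottOpenFilter L)ᵒᵈ)ᵒᵖ ⥤ C) ⥤ (Lᵒᵖ ⥤ C) :=
  (kappaFunctor L).ran ⋙ (Functor.whiskeringLeft _ _ C).obj (lambdaFunctor L)

/-- `κ^* Lan_λ`: left Kan extension along `λ`, followed by restriction along `κ`. -/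
noncomputable def kappaLanLambda [HasColimitsOfSize.{w, w} C] :
    (Lᵒᵖ ⥤ C) ⥤ (((ScottOpenFilter L)ᵒᵈ)ᵒᵖ ⥤ C) :=
  (lambdaFunctor L).lan ⋙ (Functor.whiskeringLeft _ _ C).obj (kappaFunctor L)

end Kan

/-! The functors `kappaLanLambda` and `lambdaRanKappa` are composites of the adjunctions Lan_λ ⊣ λ^*
and κ^* ⊣ Ran_κ, hence adjoint on all presheaves. It remains to see that they preserve sheaves and
that unit and counit are invertible at sheaves.

Everything rests on one sandwich. If `x` lies in a Scott-open filter `k`, continuity gives `y ∈ k`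
with `y ≪ x`, and then ↑x ⊆ `wayAbove y` ⊆ ↑y ⊆ `k`. So principal and Scott-open filters interleave,
and limits or colimits over one kind can be computed over the other. For a functor Φ on the poset of
both kinds of filters this yields two facts. If λ^*Φ is an Ω-sheaf, Φ(↑x) is the limit of the Φ(k)
with `x ∈ k` (`IsOmegaSheaf.isScottOpenLimit`), so Φ agrees with Ran_κ κ^*Φ on principal filters. If
κ^*Φ is a 𝒦-sheaf, Φ(k) is the colimit of the Φ(↑x) with `x ∈ k` (`IsKSheaf.isPrincipalColimit`), so
Φ agrees with Lan_λ λ^*Φ on Scott-open filters. As λ and κ are fully faithful, this makes the unit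
and counit invertible.

Preservation is `IsOmegaSheaf.isKSheaf` and `IsKSheaf.isOmegaSheaf`. Exactness of directed colimits
is needed only for the pullback squares of the first; the second uses limits alone. -/

theorem WayBelow.le {P : Type w} [PartialOrder P] {x y : P} (h : WayBelow x y) : x ≤ y := by
  obtain ⟨d, hd, hxd⟩ := h {y} (Set.singleton_nonempty y) (directedOn_singleton y)
    y isLUB_singleton le_rfl
  rwa [Set.mem_singleton_iff.1 hd] at hxd

theorem WayBelow.mono {P : Type w} [PartialOrder P] {x x' y y' : P} (h : WayBelow x y)
    (hx : x' ≤ x) (hy : y ≤ y') : WayBelow x' y' := fun D h1 h2 s h3 h4 =>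
  (h D h1 h2 s h3 (hy.trans h4)).imp fun _ hd => ⟨hd.1, hx.trans hd.2⟩

/-- The way-below relation of a continuous poset is interpolative. -/
theorem WayBelow.exists_between {P : Type w} [PartialOrder P] [IsContinuousPoset P] {x y : P}
    (h : WayBelow x y) : ∃ z, WayBelow x z ∧ WayBelow z y := by
  -- Continuity applied twice shows that the elements two way-below steps under `y` form a directed
  -- set with supremum `y`; `x ≪ y` then puts `x` below one of them.
  have hdir : DirectedOn (· ≤ ·) {u : P | ∃ z, WayBelow u z ∧ WayBelow z y} := by
    rintro u ⟨z, huz, hzy⟩ u' ⟨z', huz', hzy'⟩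
    obtain ⟨z'', hz'', h1, h2⟩ := IsContinuousPoset.directedOn_wayBelow y z hzy z' hzy'
    obtain ⟨u'', hu'', h3, h4⟩ := IsContinuousPoset.directedOn_wayBelow z'' u
      (huz.mono le_rfl h1) u' (huz'.mono le_rfl h2)
    exact ⟨u'', ⟨z'', hu'', hz''⟩, h3, h4⟩
  have hne : {u : P | ∃ z, WayBelow u z ∧ WayBelow z y}.Nonempty := by
    obtain ⟨z, hz⟩ := IsContinuousPoset.nonempty_wayBelow y
    obtain ⟨u, hu⟩ := IsContinuousPoset.nonempty_wayBelow z
    exact ⟨u, z, hu, hz⟩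
  have hlub : IsLUB {u : P | ∃ z, WayBelow u z ∧ WayBelow z y} y := by
    refine ⟨fun u ⟨z, huz, hzy⟩ => huz.le.trans hzy.le, fun b hb => ?_⟩
    refine (IsContinuousPoset.isLUB_wayBelow y).2 fun z hz => ?_
    exact (IsContinuousPoset.isLUB_wayBelow z).2 fun u hu => hb ⟨z, hu, hz⟩
  obtain ⟨u, ⟨z, huz, hzy⟩, hxu⟩ := h _ hne hdir y hlub le_rfl
  exact ⟨z, huz.mono hxu le_rfl, hzy⟩

/-! ### Lattice operations on Scott-open filters in terms of elements. -/

namespace ScottOpenFilter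

variable {L : Type w} [CompleteLattice L]

/-- The Scott-open filter of all elements way above `y`. -/
def wayAbove [IsStablyContinuousLattice L] (y : L) : ScottOpenFilter L where
  toPFilter := Order.IsPFilter.toPFilter (F := {z | WayBelow y z})
    (Order.IsPFilter.of_def
      ⟨⊤, IsStablyContinuousLattice.top_wayBelow_top.mono le_top le_rfl⟩
      (fun a ha b hb =>
        ⟨a ⊓ b, IsStablyContinuousLattice.wayBelow_inf _ _ _ ha hb, inf_le_left, inf_le_right⟩)
      (fun hab ha => WayBelow.mono ha le_rfl hab))
  scottOpen := by
    intro D h1 h2 s h3 hs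
    obtain ⟨z, hyz, hzs⟩ := WayBelow.exists_between (show WayBelow y s from hs)
    obtain ⟨d, hd, hzd⟩ := hzs D h1 h2 s h3 le_rfl
    exact ⟨d, hd, hyz.mono le_rfl hzd⟩

theorem exists_wayBelow_mem [IsStablyContinuousLattice L] (k : ScottOpenFilter L) {x : L}
    (hx : x ∈ k.toPFilter) : ∃ y ∈ k.toPFilter, WayBelow y x := by
  obtain ⟨y, hy, hyk⟩ := k.scottOpen (IsContinuousPoset.nonempty_wayBelow x)
    (IsContinuousPoset.directedOn_wayBelow x) (IsContinuousPoset.isLUB_wayBelow x) hx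
  exact ⟨y, hyk, hy⟩

/-- The improper filter is Scott-open because directed sets are non-empty. -/
theorem bot_mem_top [IsStablyContinuousLattice L] :
    (⊥ : L) ∈ (⊤ : ScottOpenFilter L).toPFilter := by
  let k : ScottOpenFilter L :=
    { toPFilter := Order.PFilter.principal ⊥
      scottOpen := fun D h1 _ _ _ _ => h1.imp fun d hd => ⟨hd, bot_le⟩ }
  exact (le_top : k ≤ ⊤) (show (⊥ : L) ∈ k.toPFilter from le_refl (⊥ : L))

/-- Meets come abstractly from `completeLatticeOfSup`, so the intersection has to be shown
Scott-open: directedness combines the two witnesses into one. -/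
theorem mem_inf [IsStablyContinuousLattice L] {k l : ScottOpenFilter L} {x : L} :
    x ∈ (k ⊓ l).toPFilter ↔ x ∈ k.toPFilter ∧ x ∈ l.toPFilter := by
  refine ⟨fun h => ⟨(inf_le_left : k ⊓ l ≤ k) h, (inf_le_right : k ⊓ l ≤ l) h⟩, fun h => ?_⟩
  let m : ScottOpenFilter L :=
    { toPFilter := Order.IsPFilter.toPFilter (F := {z | z ∈ k.toPFilter ∧ z ∈ l.toPFilter})
        (Order.IsPFilter.of_def ⟨⊤, Order.PFilter.top_mem, Order.PFilter.top_mem⟩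
          (fun a ha b hb => ⟨a ⊓ b, ⟨Order.PFilter.inf_mem ha.1 hb.1,
            Order.PFilter.inf_mem ha.2 hb.2⟩, inf_le_left, inf_le_right⟩)
          (fun hab ha => ⟨Order.PFilter.mem_of_le hab ha.1, Order.PFilter.mem_of_le hab ha.2⟩))
      scottOpen := by
        intro D h1 h2 s h3 hs
        obtain ⟨d, hd, hdk⟩ := k.scottOpen h1 h2 h3 hs.1
        obtain ⟨e, he, hel⟩ := l.scottOpen h1 h2 h3 hs.2
        obtain ⟨c, hc, hdc, hec⟩ := h2 d hd e he
        exact ⟨c, hc, Order.PFilter.mem_of_le hdc hdk, Order.PFilter.mem_of_le hec hel⟩ }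
  have hm : m ≤ k ⊓ l := le_inf (fun _ hz => hz.1) (fun _ hz => hz.2)
  exact hm (show x ∈ m.toPFilter from h)

theorem mem_sup [IsStablyContinuousLattice L] {k l : ScottOpenFilter L} {x : L} :
    x ∈ (k ⊔ l).toPFilter ↔ ∃ a ∈ k.toPFilter, ∃ b ∈ l.toPFilter, a ⊓ b ≤ x := by
  classical
  constructor
  · intro hx
    rw [← sSup_pair] at hx
    obtain ⟨t, ht, hx⟩ := hx
    have key : ∃ a ∈ k.toPFilter, ∃ b ∈ l.toPFilter, a ⊓ b ≤ t.inf id := by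
      clear hx
      induction t using Finset.induction_on with
      | empty => exact ⟨⊤, Order.PFilter.top_mem, ⊤, Order.PFilter.top_mem, by simp⟩
      | insert c t _ ih =>
        obtain ⟨a, ha, b, hb, hab⟩ := ih fun d hd => ht d (by simp [hd])
        obtain ⟨m, hm, hcm⟩ := ht c (by simp)
        rw [Finset.inf_insert]
        rcases hm with rfl | rfl
        · exact ⟨c ⊓ a, Order.PFilter.inf_mem hcm ha, b, hb,
            le_inf (inf_le_left.trans inf_le_left)
              ((inf_le_inf_right b inf_le_right).trans hab)⟩
        · exact ⟨a, ha, c ⊓ b, Order.PFilter.inf_mem hcm hb,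
            le_inf (inf_le_right.trans inf_le_left)
              ((inf_le_inf_left a inf_le_right).trans hab)⟩
    obtain ⟨a, ha, b, hb, hab⟩ := key
    exact ⟨a, ha, b, hb, hab.trans hx⟩
  · rintro ⟨a, ha, b, hb, hab⟩
    exact Order.PFilter.mem_of_le hab (Order.PFilter.inf_mem
      ((le_sup_left : k ≤ k ⊔ l) ha) ((le_sup_right : l ≤ k ⊔ l) hb))

/-- The finitely many generators used to reach `x` all lie in a single member of `D`. -/
theorem mem_sSup_of_directedOn [IsStablyContinuousLattice L] {D : Set (ScottOpenFilter L)}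
    (hne : D.Nonempty) (hD : DirectedOn (· ≤ ·) D) {x : L} :
    x ∈ (sSup D).toPFilter ↔ ∃ k ∈ D, x ∈ k.toPFilter := by
  classical
  constructor
  · rintro ⟨t, ht, hx⟩
    have key : ∃ k ∈ D, ∀ a ∈ t, a ∈ k.toPFilter := by
      clear hx
      induction t using Finset.induction_on with
      | empty => exact hne.imp fun k hk => ⟨hk, by simp⟩
      | insert c t _ ih =>
        obtain ⟨k, hk, hkt⟩ := ih fun d hd => ht d (by simp [hd])
        obtain ⟨m, hm, hcm⟩ := ht c (by simp)
        obtain ⟨n, hn, hkn, hmn⟩ := hD k hk m hm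
        refine ⟨n, hn, fun a ha => ?_⟩
        rcases Finset.mem_insert.1 ha with rfl | ha
        exacts [hmn hcm, hkn (hkt a ha)]
    obtain ⟨k, hk, hkt⟩ := key
    exact ⟨k, hk, Order.PFilter.mem_of_le hx (finset_inf_mem _ t hkt)⟩
  · rintro ⟨k, hk, hx⟩
    exact (le_sSup hk : k ≤ sSup D) hx

end ScottOpenFilter

namespace CategoryTheory

/-! ### Limits and colimits along families of elements of a poset -/

section Families

variable {Q : Type w} [PartialOrder Q] {C : Type u} [Category.{v} C]

/-- The action of a functor out of a poset on an inequality. -/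
abbrev Functor.mapLE (Φ : Q ⥤ C) {a b : Q} (h : a ≤ b) : Φ.obj a ⟶ Φ.obj b := Φ.map (homOfLE h)

theorem Functor.mapLE_comp (Φ : Q ⥤ C) {a b c : Q} (h : a ≤ b) (h' : b ≤ c) :
    Φ.mapLE h ≫ Φ.mapLE h' = Φ.mapLE (h.trans h') :=
  (Φ.map_comp (homOfLE h) (homOfLE h')).symm

theorem Functor.mapLE_comp_assoc (Φ : Q ⥤ C) {a b c : Q} (h : a ≤ b) (h' : b ≤ c) {T : C}
    (f : Φ.obj c ⟶ T) : Φ.mapLE h ≫ Φ.mapLE h' ≫ f = Φ.mapLE (h.trans h') ≫ f := by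
  rw [← Category.assoc, Functor.mapLE_comp]

/-- `Φ q` is the colimit of the `Φ (a i)`. -/
def IsColimitOfFamily (Φ : Q ⥤ C) {ι : Type*} (a : ι → Q) (q : Q) (h : ∀ i, a i ≤ q) : Prop :=
  ∀ (T : C) (f : ∀ i, Φ.obj (a i) ⟶ T),
    (∀ i j (hij : a i ≤ a j), Φ.mapLE hij ≫ f j = f i) →
    ∃! t : Φ.obj q ⟶ T, ∀ i, Φ.mapLE (h i) ≫ t = f i

/-- `Φ q` is the limit of the `Φ (a i)`. -/
def IsLimitOfFamily (Φ : Q ⥤ C) {ι : Type*} (a : ι → Q) (q : Q) (h : ∀ i, q ≤ a i) : Prop :=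
  ∀ (T : C) (f : ∀ i, T ⟶ Φ.obj (a i)),
    (∀ i j (hij : a i ≤ a j), f i ≫ Φ.mapLE hij = f j) →
    ∃! t : T ⟶ Φ.obj q, ∀ i, t ≫ Φ.mapLE (h i) = f i

variable {Φ Ψ : Q ⥤ C} {ι κ : Type*} {a : ι → Q} {b : κ → Q} {q : Q}

theorem IsColimitOfFamily.hom_ext {h : ∀ i, a i ≤ q} (H : IsColimitOfFamily Φ a q h) {T : C}
    {s t : Φ.obj q ⟶ T} (hst : ∀ i, Φ.mapLE (h i) ≫ s = Φ.mapLE (h i) ≫ t) : s = t :=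
  (H T (fun i => Φ.mapLE (h i) ≫ t)
    (fun i j hij => by rw [Functor.mapLE_comp_assoc])).unique hst (fun _ => rfl)

theorem IsLimitOfFamily.hom_ext {h : ∀ i, q ≤ a i} (H : IsLimitOfFamily Φ a q h) {T : C}
    {s t : T ⟶ Φ.obj q} (hst : ∀ i, s ≫ Φ.mapLE (h i) = t ≫ Φ.mapLE (h i)) : s = t :=
  (H T (fun i => t ≫ Φ.mapLE (h i))
    (fun i j hij => by rw [Category.assoc, Functor.mapLE_comp])).unique hst (fun _ => rfl)

/-- Transfer of a colimit to a directed family dominating the given one. -/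
theorem IsColimitOfFamily.trans {h : ∀ i, a i ≤ q} (H : IsColimitOfFamily Φ a q h)
    (h' : ∀ j, b j ≤ q) (hdir : ∀ i j, ∃ k, b i ≤ b k ∧ b j ≤ b k)
    (hab : ∀ i, ∃ j, a i ≤ b j)
    (hepi : ∀ j, ∃ j', ∃ hj : b j ≤ b j', ∀ (T : C) (s t : Φ.obj (b j') ⟶ T),
      (∀ i (hi : a i ≤ b j'), Φ.mapLE hi ≫ s = Φ.mapLE hi ≫ t) →
        Φ.mapLE hj ≫ s = Φ.mapLE hj ≫ t) :
    IsColimitOfFamily Φ b q h' := by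
  intro T f hf
  have indep : ∀ (p : Q) j j' (hj : p ≤ b j) (hj' : p ≤ b j'),
      Φ.mapLE hj ≫ f j = Φ.mapLE hj' ≫ f j' := by
    intro p j j' hj hj'
    obtain ⟨k, hk, hk'⟩ := hdir j j'
    rw [← hf j k hk, ← hf j' k hk', Functor.mapLE_comp_assoc, Functor.mapLE_comp_assoc]
  choose g hg using hab
  obtain ⟨t, ht, -⟩ := H T (fun i => Φ.mapLE (hg i) ≫ f (g i)) (fun i i' hii' => by
    rw [Functor.mapLE_comp_assoc]
    exact indep _ _ _ _ _)
  refine ⟨t, fun j => ?_, fun t' ht' => H.hom_ext fun i => ?_⟩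
  -- Both maps out of `b j'` agree on every `a i` below it, and `hepi` turns this into agreement on
  -- `b j`.
  · obtain ⟨j', hj, hepi⟩ := hepi j
    rw [← hf j j' hj, ← hepi T (Φ.mapLE (h' j') ≫ t) (f j') fun i hi => ?_,
      Functor.mapLE_comp_assoc]
    rw [Functor.mapLE_comp_assoc, ht i]
    exact indep _ _ _ _ _
  · rw [ht i, ← ht' (g i), Functor.mapLE_comp_assoc]

/-- Transfer of a colimit to an interleaved directed family. -/
theorem IsColimitOfFamily.of_interleaved {h : ∀ i, a i ≤ q} (H : IsColimitOfFamily Φ a q h)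
    (h' : ∀ j, b j ≤ q) (hdir : ∀ i j, ∃ k, b i ≤ b k ∧ b j ≤ b k)
    (hab : ∀ i, ∃ j, a i ≤ b j) (hba : ∀ j, ∃ i, b j ≤ a i) :
    IsColimitOfFamily Φ b q h' := by
  refine H.trans h' hdir hab fun j => ?_
  -- The inequality `b j ≤ b j'` factors through `a i`, where the two maps agree by assumption.
  obtain ⟨i, hi⟩ := hba j
  obtain ⟨j', hj'⟩ := hab i
  refine ⟨j', hi.trans hj', fun T s t hst => ?_⟩
  rw [← Functor.mapLE_comp_assoc Φ hi hj', hst i hj', Functor.mapLE_comp_assoc]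

/-- Transfer of a limit to a codirected family dominated by the given one. -/
theorem IsLimitOfFamily.trans {h : ∀ i, q ≤ a i} (H : IsLimitOfFamily Φ a q h)
    (h' : ∀ j, q ≤ b j) (hdir : ∀ i j, ∃ k, b k ≤ b i ∧ b k ≤ b j)
    (hab : ∀ i, ∃ j, b j ≤ a i)
    (hmono : ∀ j, ∃ j', ∃ hj : b j' ≤ b j, ∀ (T : C) (s t : T ⟶ Φ.obj (b j')),
      (∀ i (hi : b j' ≤ a i), s ≫ Φ.mapLE hi = t ≫ Φ.mapLE hi) →
        s ≫ Φ.mapLE hj = t ≫ Φ.mapLE hj) :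
    IsLimitOfFamily Φ b q h' := by
  intro T f hf
  have indep : ∀ (p : Q) j j' (hj : b j ≤ p) (hj' : b j' ≤ p),
      f j ≫ Φ.mapLE hj = f j' ≫ Φ.mapLE hj' := by
    intro p j j' hj hj'
    obtain ⟨k, hk, hk'⟩ := hdir j j'
    rw [← hf k j hk, ← hf k j' hk', Category.assoc, Category.assoc, Functor.mapLE_comp,
      Functor.mapLE_comp]
  choose g hg using hab
  obtain ⟨t, ht, -⟩ := H T (fun i => f (g i) ≫ Φ.mapLE (hg i)) (fun i i' hii' => by
    rw [Category.assoc, Functor.mapLE_comp]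
    exact indep _ _ _ _ _)
  refine ⟨t, fun j => ?_, fun t' ht' => H.hom_ext fun i => ?_⟩
  · obtain ⟨j', hj, hmono⟩ := hmono j
    rw [← hf j' j hj, ← hmono T (t ≫ Φ.mapLE (h' j')) (f j') fun i hi => ?_,
      Category.assoc, Functor.mapLE_comp]
    rw [Category.assoc, Functor.mapLE_comp, ht i]
    exact indep _ _ _ _ _
  · rw [ht i, ← ht' (g i), Category.assoc, Functor.mapLE_comp]

/-- Transfer of a limit to an interleaved codirected family. -/
theorem IsLimitOfFamily.of_interleaved {h : ∀ i, q ≤ a i} (H : IsLimitOfFamily Φ a q h)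
    (h' : ∀ j, q ≤ b j) (hdir : ∀ i j, ∃ k, b k ≤ b i ∧ b k ≤ b j)
    (hab : ∀ i, ∃ j, b j ≤ a i) (hba : ∀ j, ∃ i, a i ≤ b j) :
    IsLimitOfFamily Φ b q h' := by
  refine H.trans h' hdir hab fun j => ?_
  obtain ⟨i, hi⟩ := hba j
  obtain ⟨j', hj'⟩ := hab i
  refine ⟨j', hj'.trans hi, fun T s t hst => ?_⟩
  rw [← Functor.mapLE_comp Φ hj' hi, ← Category.assoc, hst i hj', Category.assoc]

/-- The inverse at `q` is glued from the inverses at the `a i`. This is how a comparison map with a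
Kan extension is recognised as invertible. -/
theorem IsColimitOfFamily.isIso_app {h : ∀ i, a i ≤ q} (HΨ : IsColimitOfFamily Ψ a q h)
    (HΦ : IsColimitOfFamily Φ a q h) (τ : Ψ ⟶ Φ) [∀ i, IsIso (τ.app (a i))] :
    IsIso (τ.app q) := by
  obtain ⟨t, ht, -⟩ := HΦ (Ψ.obj q) (fun i => inv (τ.app (a i)) ≫ Ψ.mapLE (h i))
    (fun i j hij => by
      rw [IsIso.eq_inv_comp, ← Category.assoc, ← τ.naturality, Category.assoc,
        IsIso.hom_inv_id_assoc, Functor.mapLE_comp])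
  refine ⟨t, HΨ.hom_ext fun i => ?_, HΦ.hom_ext fun i => ?_⟩
  · rw [← Category.assoc, τ.naturality, Category.assoc, ht, IsIso.hom_inv_id_assoc,
      Category.comp_id]
  · rw [← Category.assoc, ht, Category.assoc, τ.naturality, IsIso.inv_hom_id_assoc,
      Category.comp_id]

theorem IsLimitOfFamily.isIso_app {h : ∀ i, q ≤ a i} (HΨ : IsLimitOfFamily Ψ a q h)
    (HΦ : IsLimitOfFamily Φ a q h) (τ : Ψ ⟶ Φ) [∀ i, IsIso (τ.app (a i))] :
    IsIso (τ.app q) := by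
  obtain ⟨t, ht, -⟩ := HΨ (Φ.obj q) (fun i => Φ.mapLE (h i) ≫ inv (τ.app (a i)))
    (fun i j hij => by
      rw [IsIso.eq_comp_inv, Category.assoc, τ.naturality, Category.assoc,
        IsIso.inv_hom_id_assoc, Functor.mapLE_comp] )
  refine ⟨t, HΨ.hom_ext fun i => ?_, HΦ.hom_ext fun i => ?_⟩
  · rw [Category.assoc, ht, ← Category.assoc, ← τ.naturality, Category.assoc, IsIso.hom_inv_id,
      Category.comp_id, Category.id_comp]
  · rw [Category.assoc, ← τ.naturality, ← Category.assoc, ht, Category.assoc, IsIso.inv_hom_id,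
      Category.comp_id, Category.id_comp]

section Cocones

variable {J : Type*} [Category J] (A : J ⥤ Q)

/-- The cocone with vertex `Φ q` on `A ⋙ Φ`. -/
def familyCocone (Φ : Q ⥤ C) (q : Q) (h : ∀ j, A.obj j ≤ q) : Cocone (A ⋙ Φ) where
  pt := Φ.obj q
  ι :=
    { app := fun j => Φ.mapLE (h j)
      naturality := fun _ j f =>
        (Φ.map_comp (A.map f) (homOfLE (h j))).symm.trans (Category.comp_id _).symm }

/-- The cone with vertex `Φ q` on `A ⋙ Φ`. -/
def familyCone (Φ : Q ⥤ C) (q : Q) (h : ∀ j, q ≤ A.obj j) : Cone (A ⋙ Φ) where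
  pt := Φ.obj q
  π :=
    { app := fun j => Φ.mapLE (h j)
      naturality := fun i _ f =>
        (Category.id_comp _).trans (Φ.map_comp (homOfLE (h i)) (A.map f)) }

variable {A}

/-- A cocone is compatible along arrows of `J` only, a family along all inequalities in `Q`; the
common bound `k` supplies the missing compatibilities. -/
theorem IsColimitOfFamily.nonempty_isColimit {h : ∀ j, A.obj j ≤ q}
    (hA : ∀ i j, A.obj i ≤ A.obj j → ∃ k, Nonempty (i ⟶ k) ∧ Nonempty (j ⟶ k))
    (H : IsColimitOfFamily Φ A.obj q h) : Nonempty (IsColimit (familyCocone A Φ q h)) := by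
  have key : ∀ s : Cocone (A ⋙ Φ), ∃! t : Φ.obj q ⟶ s.pt, ∀ j, Φ.mapLE (h j) ≫ t = s.ι.app j := by
    intro s
    refine H s.pt s.ι.app fun i j hij => ?_
    obtain ⟨k, ⟨f⟩, ⟨g⟩⟩ := hA i j hij
    rw [← s.w f, ← s.w g]
    exact Functor.mapLE_comp_assoc Φ hij (leOfHom (A.map g)) _
  choose t ht ht' using key
  exact ⟨{ desc := t, fac := ht, uniq := ht' }⟩

theorem isColimitOfFamily_of_isColimit {h : ∀ j, A.obj j ≤ q}
    (H : IsColimit (familyCocone A Φ q h)) : IsColimitOfFamily Φ A.obj q h := by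
  intro T f hf
  let s : Cocone (A ⋙ Φ) :=
    { pt := T
      ι := { app := f
             naturality := fun i j g =>
              (hf i j (leOfHom (A.map g))).trans (Category.comp_id _).symm } }
  exact ⟨H.desc s, H.fac s, fun t ht => H.uniq s t ht⟩

theorem IsLimitOfFamily.nonempty_isLimit {h : ∀ j, q ≤ A.obj j}
    (hA : ∀ i j, A.obj i ≤ A.obj j → Nonempty (i ⟶ j))
    (H : IsLimitOfFamily Φ A.obj q h) : Nonempty (IsLimit (familyCone A Φ q h)) := by
  have key : ∀ s : Cone (A ⋙ Φ), ∃! t : s.pt ⟶ Φ.obj q, ∀ j, t ≫ Φ.mapLE (h j) = s.π.app j := by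
    intro s
    refine H s.pt s.π.app fun i j hij => ?_
    obtain ⟨f⟩ := hA i j hij
    exact s.w f
  choose t ht ht' using key
  exact ⟨{ lift := t, fac := ht, uniq := ht' }⟩

theorem isLimitOfFamily_of_isLimit {h : ∀ j, q ≤ A.obj j}
    (H : IsLimit (familyCone A Φ q h)) : IsLimitOfFamily Φ A.obj q h := by
  intro T f hf
  let s : Cone (A ⋙ Φ) :=
    { pt := T
      π := { app := f
             naturality := fun i j g =>
              (Category.id_comp _).trans (hf i j (leOfHom (A.map g))).symm } }
  exact ⟨H.lift s, H.fac s, fun t ht => H.uniq s t ht⟩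

end Cocones

/-- A colimit of pullback squares along a shape with exact colimits is a pullback square. -/
theorem IsPullback.of_isColimit_of_exact {J : Type w} [Category.{w} J] [HasColimitsOfShape J C]
    [HasExactColimitsOfShape J C] {F₁ F₂ F₃ F₄ : J ⥤ C}
    {f₁₂ : F₁ ⟶ F₂} {f₁₃ : F₁ ⟶ F₃} {f₂₄ : F₂ ⟶ F₄} {f₃₄ : F₃ ⟶ F₄}
    (sq : ∀ j, IsPullback (f₁₂.app j) (f₁₃.app j) (f₂₄.app j) (f₃₄.app j))
    {c₁ : Cocone F₁} {c₂ : Cocone F₂} {c₃ : Cocone F₃} {c₄ : Cocone F₄}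
    (h₁ : IsColimit c₁) (h₂ : IsColimit c₂) (h₃ : IsColimit c₃) (h₄ : IsColimit c₄)
    {g₁₂ : c₁.pt ⟶ c₂.pt} {g₁₃ : c₁.pt ⟶ c₃.pt} {g₂₄ : c₂.pt ⟶ c₄.pt} {g₃₄ : c₃.pt ⟶ c₄.pt}
    (w₁₂ : ∀ j, c₁.ι.app j ≫ g₁₂ = f₁₂.app j ≫ c₂.ι.app j)
    (w₁₃ : ∀ j, c₁.ι.app j ≫ g₁₃ = f₁₃.app j ≫ c₃.ι.app j)
    (w₂₄ : ∀ j, c₂.ι.app j ≫ g₂₄ = f₂₄.app j ≫ c₄.ι.app j)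
    (w₃₄ : ∀ j, c₃.ι.app j ≫ g₃₄ = f₃₄.app j ≫ c₄.ι.app j) :
    IsPullback g₁₂ g₁₃ g₂₄ g₃₄ := by
  have : PreservesFiniteLimits (colim (J := J) (C := C)) :=
    HasExactColimitsOfShape.preservesFiniteLimits
  -- Naturality of the comparison between the chosen colimits, where exactness applies, and the
  -- given ones.
  have key : ∀ {F G : J ⥤ C} (f : F ⟶ G) {c : Cocone F} {d : Cocone G} (hc : IsColimit c)
      (hd : IsColimit d) (g : c.pt ⟶ d.pt) (_ : ∀ j, c.ι.app j ≫ g = f.app j ≫ d.ι.app j),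
      colim.map f ≫ ((colimit.isColimit G).coconePointUniqueUpToIso hd).hom =
        ((colimit.isColimit F).coconePointUniqueUpToIso hc).hom ≫ g := by
    intro F G f c d hc hd g w
    refine colimit.hom_ext fun j => ?_
    have e₁ := (colimit.isColimit F).comp_coconePointUniqueUpToIso_hom hc j
    have e₂ := (colimit.isColimit G).comp_coconePointUniqueUpToIso_hom hd j
    dsimp at e₁ e₂
    rw [← Category.assoc, ← Category.assoc, e₁, w]
    simp [e₂]
  exact ((IsPullback.of_forall_isPullback_app sq).map colim).of_iso
    ((colimit.isColimit F₁).coconePointUniqueUpToIso h₁)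
    ((colimit.isColimit F₂).coconePointUniqueUpToIso h₂)
    ((colimit.isColimit F₃).coconePointUniqueUpToIso h₃)
    ((colimit.isColimit F₄).coconePointUniqueUpToIso h₄)
    (key _ h₁ h₂ _ w₁₂) (key _ h₁ h₃ _ w₁₃) (key _ h₂ h₄ _ w₂₄) (key _ h₃ h₄ _ w₃₄)

/-- A directed colimit of pullback squares is a pullback square, for families of elements of a
poset. -/
theorem isPullback_of_isColimitOfFamily {J : Type w} [PartialOrder J] [IsDirectedOrder J]
    [HasColimitsOfShape J C] [HasExactColimitsOfShape J C] {a₁ a₂ a₃ a₄ : J → Q}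
    (m₁ : Monotone a₁) (m₂ : Monotone a₂) (m₃ : Monotone a₃) (m₄ : Monotone a₄)
    (a₁₂ : ∀ j, a₁ j ≤ a₂ j) (a₁₃ : ∀ j, a₁ j ≤ a₃ j) (a₂₄ : ∀ j, a₂ j ≤ a₄ j)
    (a₃₄ : ∀ j, a₃ j ≤ a₄ j)
    (sq : ∀ j, IsPullback (Φ.mapLE (a₁₂ j)) (Φ.mapLE (a₁₃ j)) (Φ.mapLE (a₂₄ j))
      (Φ.mapLE (a₃₄ j)))
    {q₁ q₂ q₃ q₄ : Q} {h₁ : ∀ j, a₁ j ≤ q₁} {h₂ : ∀ j, a₂ j ≤ q₂} {h₃ : ∀ j, a₃ j ≤ q₃}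
    {h₄ : ∀ j, a₄ j ≤ q₄}
    (H₁ : IsColimitOfFamily Φ a₁ q₁ h₁) (H₂ : IsColimitOfFamily Φ a₂ q₂ h₂)
    (H₃ : IsColimitOfFamily Φ a₃ q₃ h₃) (H₄ : IsColimitOfFamily Φ a₄ q₄ h₄)
    (q₁₂ : q₁ ≤ q₂) (q₁₃ : q₁ ≤ q₃) (q₂₄ : q₂ ≤ q₄) (q₃₄ : q₃ ≤ q₄) :
    IsPullback (Φ.mapLE q₁₂) (Φ.mapLE q₁₃) (Φ.mapLE q₂₄) (Φ.mapLE q₃₄) := by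
  have colim : ∀ {a : J → Q} (m : Monotone a) {q : Q} {h : ∀ j, a j ≤ q}
      (_ : IsColimitOfFamily Φ a q h), Nonempty (IsColimit (familyCocone m.functor Φ q h)) := by
    intro a m q h H
    refine IsColimitOfFamily.nonempty_isColimit (fun i j _ => ?_) H
    obtain ⟨c, hc, hc'⟩ := exists_ge_ge i j
    exact ⟨c, ⟨homOfLE hc⟩, ⟨homOfLE hc'⟩⟩
  let τ {a b : J → Q} (m : Monotone a) (n : Monotone b) (hab : ∀ j, a j ≤ b j) :
      m.functor ⋙ Φ ⟶ n.functor ⋙ Φ :=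
    { app := fun j => Φ.mapLE (hab j)
      naturality := fun i j f =>
        (Functor.mapLE_comp Φ (m (leOfHom f)) (hab j)).trans
          (Functor.mapLE_comp Φ (hab i) (n (leOfHom f))).symm }
  obtain ⟨c₁⟩ := colim m₁ H₁
  obtain ⟨c₂⟩ := colim m₂ H₂
  obtain ⟨c₃⟩ := colim m₃ H₃
  obtain ⟨c₄⟩ := colim m₄ H₄
  exact IsPullback.of_isColimit_of_exact
    (f₁₂ := τ m₁ m₂ a₁₂) (f₁₃ := τ m₁ m₃ a₁₃) (f₂₄ := τ m₂ m₄ a₂₄) (f₃₄ := τ m₃ m₄ a₃₄)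
    sq c₁ c₂ c₃ c₄
    (fun j => (Functor.mapLE_comp Φ (h₁ j) q₁₂).trans
      (Functor.mapLE_comp Φ (a₁₂ j) (h₂ j)).symm)
    (fun j => (Functor.mapLE_comp Φ (h₁ j) q₁₃).trans
      (Functor.mapLE_comp Φ (a₁₃ j) (h₃ j)).symm)
    (fun j => (Functor.mapLE_comp Φ (h₂ j) q₂₄).trans
      (Functor.mapLE_comp Φ (a₂₄ j) (h₄ j)).symm)
    (fun j => (Functor.mapLE_comp Φ (h₃ j) q₃₄).trans
      (Functor.mapLE_comp Φ (a₃₄ j) (h₄ j)).symm)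

end Families

end CategoryTheory

/-! ### Invariance of the sheaf conditions under isomorphism. -/

section IsoInvariance

variable {P : Type w} [CompleteLattice P] {C : Type u} [Category.{v} C] {F G : Pᵒᵖ ⥤ C}

theorem isSubterminal_of_iso {A B : C} (e : A ≅ B) (hA : IsSubterminal A) : IsSubterminal B :=
  fun Z f g => by
    rw [← cancel_mono e.inv]
    exact hA _ _

theorem SupInfPullback.of_iso (e : F ≅ G) (hF : SupInfPullback F) : SupInfPullback G :=
  fun p q => (hF p q).of_iso (e.app _) (e.app _) (e.app _) (e.app _)
    (e.hom.naturality _) (e.hom.naturality _) (e.hom.naturality _) (e.hom.naturality _)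

theorem IsOmegaSheaf.of_iso (e : F ≅ G) (hF : IsOmegaSheaf F) : IsOmegaSheaf G where
  subterminal := isSubterminal_of_iso (e.app _) hF.subterminal
  pullback := hF.pullback.of_iso e
  limit D hne hD := by
    obtain ⟨h⟩ := hF.limit D hne hD
    let e' : restrictToSubset F D ≅ restrictToSubset G D := Functor.isoWhiskerLeft _ e
    exact ⟨IsLimit.ofIsoLimit ((IsLimit.postcomposeHomEquiv e' _).symm h)
      (Cone.ext (e.app _) fun p => (e.hom.naturality _))⟩

theorem IsKSheaf.of_iso (e : F ≅ G) (hF : IsKSheaf F) : IsKSheaf G where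
  subterminal := isSubterminal_of_iso (e.app _) hF.subterminal
  pullback := hF.pullback.of_iso e
  colimit D hne hD := by
    obtain ⟨h⟩ := hF.colimit D hne hD
    let e' : restrictToSubset G D ≅ restrictToSubset F D := Functor.isoWhiskerLeft _ e.symm
    exact ⟨IsColimit.ofIsoColimit ((IsColimit.precomposeHomEquiv e' _).symm h)
      (Cocone.ext (e.app _) fun p =>
        ((Category.assoc _ _ _).trans (congrArg (e.inv.app _ ≫ ·) (e.hom.naturality _))).trans
          (e.inv_hom_id_app_assoc _ _))⟩

end IsoInvariance

/-! ### Principal and Scott-open filters in one poset, and their interleaving. -/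

section Kan

variable {L : Type w} [CompleteLattice L] {C : Type u} [Category.{v} C]

instance : (lambdaFunctor L).Full where
  map_surjective f :=
    ⟨(homOfLE (Order.PFilter.principal_le_principal_iff.1 (leOfHom f))).op, rfl⟩

instance : (lambdaFunctor L).Faithful where
  map_injective _ := Quiver.Hom.unop_inj (Subsingleton.elim _ _)

instance : (kappaFunctor L).Full where
  map_surjective f := ⟨(homOfLE (leOfHom f)).op, rfl⟩

instance : (kappaFunctor L).Faithful where
  map_injective _ := Quiver.Hom.unop_inj (Subsingleton.elim _ _)

/-- The principal filter of `x`, as an element of the poset of principal or Scott-open filters. -/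
abbrev principalFilter (x : L) : PrincipalOrScottOpenFilter L := (lambdaFunctor L).obj (op x)

/-- A Scott-open filter, as an element of the poset of principal or Scott-open filters. -/
abbrev ScottOpenFilter.toPrincipalOrScottOpen (k : ScottOpenFilter L) :
    PrincipalOrScottOpenFilter L :=
  (kappaFunctor L).obj (op (OrderDual.toDual k))

open ScottOpenFilter

theorem principalFilter_le {x : L} {φ : PrincipalOrScottOpenFilter L} :
    principalFilter x ≤ φ ↔ x ∈ φ.1 :=
  ⟨fun h => h (show x ∈ Order.PFilter.principal x from le_refl x),
    fun h _ hy => Order.PFilter.mem_of_le hy h⟩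

theorem principalFilter_le_principalFilter {x y : L} :
    principalFilter x ≤ principalFilter y ↔ y ≤ x :=
  principalFilter_le

theorem principalFilter_le_toPrincipalOrScottOpen {x : L} {k : ScottOpenFilter L} :
    principalFilter x ≤ k.toPrincipalOrScottOpen ↔ x ∈ k.toPFilter :=
  principalFilter_le

theorem toPrincipalOrScottOpen_le {k l : ScottOpenFilter L} :
    k.toPrincipalOrScottOpen ≤ l.toPrincipalOrScottOpen ↔ k ≤ l := Iff.rfl

theorem wayAbove_le [IsStablyContinuousLattice L] {y : L} {φ : PrincipalOrScottOpenFilter L}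
    (h : y ∈ φ.1) : (wayAbove y).toPrincipalOrScottOpen ≤ φ :=
  fun _ hz => Order.PFilter.mem_of_le (WayBelow.le hz) h

/-- Both filters are all of `L`, so the two subterminality conditions concern the same object. -/
theorem toPrincipalOrScottOpen_top [IsStablyContinuousLattice L] :
    (⊤ : ScottOpenFilter L).toPrincipalOrScottOpen = principalFilter ⊥ :=
  le_antisymm (fun _ _ => bot_le (α := L)) (principalFilter_le.2 bot_mem_top)

/-- `Φ` is the pointwise left Kan extension along `λ` of its restriction, at `k`. -/
def IsPrincipalColimit (Φ : PrincipalOrScottOpenFilter L ⥤ C) (k : ScottOpenFilter L) : Prop :=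
  IsColimitOfFamily Φ (fun x : {x // x ∈ k.toPFilter} => principalFilter x.1)
    k.toPrincipalOrScottOpen fun x => principalFilter_le.2 x.2

/-- `Φ` is the pointwise right Kan extension along `κ` of its restriction, at `x`. -/
def IsScottOpenLimit (Φ : PrincipalOrScottOpenFilter L ⥤ C) (x : L) : Prop :=
  IsLimitOfFamily Φ (fun k : {k : ScottOpenFilter L // x ∈ k.toPFilter} =>
    k.1.toPrincipalOrScottOpen) (principalFilter x) fun k => principalFilter_le.2 k.2

variable {Φ : PrincipalOrScottOpenFilter L ⥤ C}

theorem exists_mem_le_le {k : ScottOpenFilter L} (x y : {x // x ∈ k.toPFilter}) :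
    ∃ z : {x // x ∈ k.toPFilter}, principalFilter x.1 ≤ principalFilter z.1 ∧
      principalFilter y.1 ≤ principalFilter z.1 :=
  ⟨⟨x.1 ⊓ y.1, Order.PFilter.inf_mem x.2 y.2⟩,
    principalFilter_le_principalFilter.2 inf_le_left,
    principalFilter_le_principalFilter.2 inf_le_right⟩

/-- Restriction of the colimit condition of a `𝒦`-sheaf to families. -/
theorem IsKSheaf.isColimitOfFamily [IsStablyContinuousLattice L]
    (h : IsKSheaf (kappaFunctor L ⋙ Φ)) {D : Set (ScottOpenFilter L)} (hne : D.Nonempty)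
    (hD : DirectedOn (· ≤ ·) D) :
    IsColimitOfFamily Φ (fun k : D => k.1.toPrincipalOrScottOpen)
      (sSup D).toPrincipalOrScottOpen fun k => toPrincipalOrScottOpen_le.2 (le_sSup k.2) := by
  -- In the order dual, codirected sets and infima become directed sets and suprema of filters.
  obtain ⟨H⟩ := h.colimit (OrderDual.ofDual ⁻¹' D) hne hD
  have H' := isColimitOfFamily_of_isColimit
    (A := (Subtype.mono_coe (· ∈ OrderDual.ofDual ⁻¹' D)).functor.op ⋙ kappaFunctor L)
    (Φ := Φ) (q := (sSup D).toPrincipalOrScottOpen)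
    (h := fun k => toPrincipalOrScottOpen_le.2 (le_sSup k.unop.2)) H
  intro T f hf
  obtain ⟨t, ht, ht'⟩ := H' T (fun k => f k.unop) fun i j hij => hf _ _ hij
  exact ⟨t, fun k => ht (op k), fun s hs => ht' s fun k => hs k.unop⟩

/-- Restriction of the limit condition of an `Ω`-sheaf to families. -/
theorem IsOmegaSheaf.isLimitOfFamily (h : IsOmegaSheaf (lambdaFunctor L ⋙ Φ)) {D : Set L}
    (hne : D.Nonempty) (hD : DirectedOn (· ≤ ·) D) :
    IsLimitOfFamily Φ (fun x : D => principalFilter x.1) (principalFilter (sSup D))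
      fun x => principalFilter_le_principalFilter.2 (le_sSup x.2) := by
  obtain ⟨H⟩ := h.limit D hne hD
  have H' := isLimitOfFamily_of_isLimit
    (A := (Subtype.mono_coe (· ∈ D)).functor.op ⋙ lambdaFunctor L)
    (Φ := Φ) (q := principalFilter (sSup D))
    (h := fun k => principalFilter_le_principalFilter.2 (le_sSup k.unop.2)) H
  intro T f hf
  obtain ⟨t, ht, ht'⟩ := H' T (fun k => f k.unop) fun i j hij => hf _ _ hij
  exact ⟨t, fun k => ht (op k), fun s hs => ht' s fun k => hs k.unop⟩

theorem IsKSheaf.isPrincipalColimit [IsStablyContinuousLattice L]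
    (h : IsKSheaf (kappaFunctor L ⋙ Φ)) (k : ScottOpenFilter L) : IsPrincipalColimit Φ k := by
  -- The Scott-open filters contained in ↑x for some `x ∈ k`. By the sandwich they are directed with
  -- union `k`, and they interleave with the principal filters inside `k`.
  let D : Set (ScottOpenFilter L) := {l | ∃ x ∈ k.toPFilter, ∀ z ∈ l.toPFilter, x ≤ z}
  have key : ∀ x ∈ k.toPFilter, ∃ l ∈ D, x ∈ l.toPFilter := fun x hx => by
    obtain ⟨y, hy, hyx⟩ := k.exists_wayBelow_mem hx
    exact ⟨wayAbove y, ⟨y, hy, fun z hz => WayBelow.le hz⟩, hyx⟩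
  have hne : D.Nonempty := (key ⊤ Order.PFilter.top_mem).imp fun _ h => h.1
  have hD : DirectedOn (· ≤ ·) D := by
    rintro l ⟨x, hx, hl⟩ m ⟨y, hy, hm⟩
    obtain ⟨n, hn, hxy⟩ := key (x ⊓ y) (Order.PFilter.inf_mem hx hy)
    exact ⟨n, hn, fun z hz => Order.PFilter.mem_of_le (inf_le_left.trans (hl z hz)) hxy,
      fun z hz => Order.PFilter.mem_of_le (inf_le_right.trans (hm z hz)) hxy⟩
  have hsup : sSup D = k := by
    refine le_antisymm (sSup_le ?_) fun x hx => ?_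
    · rintro l ⟨x, hx, hl⟩ z hz
      exact Order.PFilter.mem_of_le (hl z hz) hx
    · exact (mem_sSup_of_directedOn hne hD).2 (key x hx)
  have H := h.isColimitOfFamily hne hD
  simp only [hsup] at H
  refine H.of_interleaved _ exists_mem_le_le ?_ ?_
  · rintro ⟨l, x, hx, hl⟩
    exact ⟨⟨x, hx⟩, hl⟩
  · rintro ⟨x, hx⟩
    obtain ⟨l, hl, hxl⟩ := key x hx
    exact ⟨⟨l, hl⟩, principalFilter_le.2 hxl⟩

/-- By continuity Φ(↑x) is the limit over the `y ≪ x`. The filters ↑y with `y ≪ x` interleave with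
the Scott-open filters containing `x`: `wayAbove y` lies inside ↑y, and each such filter contains
some `y ≪ x`. -/
theorem IsOmegaSheaf.isScottOpenLimit [IsStablyContinuousLattice L]
    (h : IsOmegaSheaf (lambdaFunctor L ⋙ Φ)) (x : L) : IsScottOpenLimit Φ x := by
  have H := h.isLimitOfFamily (IsContinuousPoset.nonempty_wayBelow x)
    (IsContinuousPoset.directedOn_wayBelow x)
  simp only [(IsContinuousPoset.isLUB_wayBelow x).sSup_eq] at H
  refine H.of_interleaved _ ?_ ?_ ?_
  · rintro ⟨k, hk⟩ ⟨l, hl⟩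
    exact ⟨⟨k ⊓ l, mem_inf.2 ⟨hk, hl⟩⟩, toPrincipalOrScottOpen_le.2 inf_le_left,
      toPrincipalOrScottOpen_le.2 inf_le_right⟩
  · rintro ⟨y, hy⟩
    exact ⟨⟨wayAbove y, hy⟩, wayAbove_le (φ := principalFilter y) (le_refl y)⟩
  · rintro ⟨k, hk⟩
    obtain ⟨y, hyk, hy⟩ := k.exists_wayBelow_mem hk
    exact ⟨⟨y, hy⟩, principalFilter_le.2 hyk⟩

/-! ### Preservation of the sheaf conditions -/

/-- The square is the directed colimit, over pairs `x ∈ k`, `y ∈ l`, of the pullback squares given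
by `hΩ`: the elements `x ⊔ y`, `x`, `y`, `x ⊓ y` are cofinal in `k ⊓ l`, `k`, `l`, `k ⊔ l`
respectively. -/
theorem isPullback_of_isPrincipalColimit [IsStablyContinuousLattice L]
    [HasColimitsOfSize.{w, w} C]
    (hC : ∀ (J : Type w) [PartialOrder J] [Nonempty J] [IsDirectedOrder J],
      HasExactColimitsOfShape J C)
    (hΩ : SupInfPullback (lambdaFunctor L ⋙ Φ)) (hΦ : ∀ k, IsPrincipalColimit Φ k)
    (k l : ScottOpenFilter L) :
    IsPullback
      (Φ.mapLE (toPrincipalOrScottOpen_le.2 (inf_le_left : k ⊓ l ≤ k)))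
      (Φ.mapLE (toPrincipalOrScottOpen_le.2 (inf_le_right : k ⊓ l ≤ l)))
      (Φ.mapLE (toPrincipalOrScottOpen_le.2 (le_sup_left : k ≤ k ⊔ l)))
      (Φ.mapLE (toPrincipalOrScottOpen_le.2 (le_sup_right : l ≤ k ⊔ l))) := by
  let I := {x // x ∈ k.toPFilter} × {y // y ∈ l.toPFilter}
  -- Smaller elements generate larger principal filters, hence the order dual.
  let J := Iᵒᵈ
  let pr (i : J) : I := OrderDual.ofDual i
  have : Nonempty J := ⟨OrderDual.toDual ⟨⟨⊤, Order.PFilter.top_mem⟩, ⟨⊤, Order.PFilter.top_mem⟩⟩⟩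
  have hdir : IsDirectedOrder J := ⟨fun i j => ⟨OrderDual.toDual
    ⟨⟨(pr i).1.1 ⊓ (pr j).1.1, Order.PFilter.inf_mem (pr i).1.2 (pr j).1.2⟩,
      ⟨(pr i).2.1 ⊓ (pr j).2.1, Order.PFilter.inf_mem (pr i).2.2 (pr j).2.2⟩⟩,
      show _ ≤ pr i from ⟨inf_le_left, inf_le_left⟩,
      show _ ≤ pr j from ⟨inf_le_right, inf_le_right⟩⟩⟩
  have := hC J
  have colim : ∀ (m : L → L → L)
      (hm : ∀ {x x' y y' : L}, x ≤ x' → y ≤ y' → m x y ≤ m x' y') (n : ScottOpenFilter L)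
      (hn : ∀ x ∈ k.toPFilter, ∀ y ∈ l.toPFilter, m x y ∈ n.toPFilter)
      (_ : ∀ z ∈ n.toPFilter, ∃ x ∈ k.toPFilter, ∃ y ∈ l.toPFilter, m x y ≤ z),
      Monotone (fun i : J => principalFilter (m (pr i).1.1 (pr i).2.1)) ∧
      IsColimitOfFamily Φ (fun i : J => principalFilter (m (pr i).1.1 (pr i).2.1))
        n.toPrincipalOrScottOpen fun i => principalFilter_le.2 (hn _ (pr i).1.2 _ (pr i).2.2) := by
    intro m hm n hn hn'
    have mono : Monotone (fun i : J => principalFilter (m (pr i).1.1 (pr i).2.1)) :=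
      fun i j hij => principalFilter_le_principalFilter.2
        (hm (show pr j ≤ pr i from hij).1 (show pr j ≤ pr i from hij).2)
    refine ⟨mono, (hΦ n).of_interleaved _ (fun i j => ?_) ?_ ?_⟩
    · obtain ⟨c, hc, hc'⟩ := exists_ge_ge i j
      exact ⟨c, mono hc, mono hc'⟩
    · rintro ⟨z, hz⟩
      obtain ⟨x, hx, y, hy, hxy⟩ := hn' z hz
      exact ⟨OrderDual.toDual ⟨⟨x, hx⟩, ⟨y, hy⟩⟩, principalFilter_le_principalFilter.2 hxy⟩
    · exact fun i => ⟨⟨_, hn _ (pr i).1.2 _ (pr i).2.2⟩, le_rfl⟩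
  obtain ⟨m₁, h₁⟩ := colim (· ⊔ ·) sup_le_sup (k ⊓ l)
    (fun x hx y hy => mem_inf.2 ⟨Order.PFilter.mem_of_le le_sup_left hx,
      Order.PFilter.mem_of_le le_sup_right hy⟩)
    (fun z hz => ⟨z, (mem_inf.1 hz).1, z, (mem_inf.1 hz).2, (sup_idem z).le⟩)
  obtain ⟨m₂, h₂⟩ := colim (fun x _ => x) (fun h _ => h) k (fun x hx _ _ => hx)
    (fun z hz => ⟨z, hz, ⊤, Order.PFilter.top_mem, le_rfl⟩)
  obtain ⟨m₃, h₃⟩ := colim (fun _ y => y) (fun _ h => h) l (fun _ _ y hy => hy)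
    (fun z hz => ⟨⊤, Order.PFilter.top_mem, z, hz, le_rfl⟩)
  obtain ⟨m₄, h₄⟩ := colim (· ⊓ ·) inf_le_inf (k ⊔ l)
    (fun x hx y hy => mem_sup.2 ⟨x, hx, y, hy, le_rfl⟩) (fun z hz => mem_sup.1 hz)
  exact isPullback_of_isColimitOfFamily m₁ m₂ m₃ m₄
    (fun _ => principalFilter_le_principalFilter.2 le_sup_left)
    (fun _ => principalFilter_le_principalFilter.2 le_sup_right)
    (fun _ => principalFilter_le_principalFilter.2 inf_le_left)
    (fun _ => principalFilter_le_principalFilter.2 inf_le_right)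
    (fun i => hΩ (pr i).1.1 (pr i).2.1) h₁ h₂ h₃ h₄ _ _ _ _

theorem IsOmegaSheaf.isKSheaf [IsStablyContinuousLattice L] [HasColimitsOfSize.{w, w} C]
    (hC : ∀ (J : Type w) [PartialOrder J] [Nonempty J] [IsDirectedOrder J],
      HasExactColimitsOfShape J C)
    (h : IsOmegaSheaf (lambdaFunctor L ⋙ Φ)) (hΦ : ∀ k, IsPrincipalColimit Φ k) :
    IsKSheaf (kappaFunctor L ⋙ Φ) where
  subterminal := isSubterminal_of_iso
    (Φ.mapIso (eqToIso (toPrincipalOrScottOpen_top (L := L)).symm)) h.subterminal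
  pullback p q := isPullback_of_isPrincipalColimit hC h.pullback hΦ
    (OrderDual.ofDual p) (OrderDual.ofDual q)
  colimit D hne hD := by
    have hmem : ∀ x : L, x ∈ (OrderDual.ofDual (sInf D)).toPFilter ↔
        ∃ k ∈ D, x ∈ (OrderDual.ofDual k).toPFilter := fun x =>
      mem_sSup_of_directedOn (D := OrderDual.toDual ⁻¹' D) hne hD
    refine IsColimitOfFamily.nonempty_isColimit (Φ := Φ)
      (A := (Subtype.mono_coe (· ∈ D)).functor.op ⋙ kappaFunctor L)
      (q := (kappaFunctor L).obj (op (sInf D)))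
      (h := fun k => leOfHom ((kappaFunctor L).map (homOfLE (sInf_le k.unop.2)).op))
      (fun i j hij => ⟨j, ⟨(homOfLE (show j.unop ≤ i.unop from hij)).op⟩, ⟨𝟙 _⟩⟩) ?_
    refine (hΦ (OrderDual.ofDual (sInf D))).trans _ ?_ ?_ ?_
    · intro i j
      obtain ⟨c, hc, hic, hjc⟩ := hD _ i.unop.2 _ j.unop.2
      exact ⟨op ⟨c, hc⟩, hic, hjc⟩
    · rintro ⟨x, hx⟩
      obtain ⟨k, hk, hxk⟩ := (hmem x).1 hx
      exact ⟨op ⟨k, hk⟩, principalFilter_le.2 hxk⟩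
    -- The value at a member of `D` is itself a colimit over its elements, so these are jointly
    -- epimorphic there.
    · refine fun j => ⟨j, le_rfl, fun T s t hst => congrArg _ ?_⟩
      refine (hΦ (OrderDual.ofDual j.unop.1)).hom_ext fun x => ?_
      exact hst ⟨x.1, (hmem x.1).2 ⟨j.unop.1, j.unop.2, x.2⟩⟩ (principalFilter_le.2 x.2)

/-- The meets `k ⊓ l` with `x ∈ k`, `y ∈ l` are coinitial among the Scott-open filters containing `x
⊔ y`, so lifts into the pullbacks for all such pairs assemble to one lift. The value at `x ⊓ y`
enters only through its maps to `k ⊔ l` and needs no limit description. -/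
theorem isPullback_of_isScottOpenLimit [IsStablyContinuousLattice L]
    (hK : SupInfPullback (kappaFunctor L ⋙ Φ)) (hΦ : ∀ x, IsScottOpenLimit Φ x) (x y : L) :
    IsPullback
      (Φ.mapLE (principalFilter_le_principalFilter.2 (le_sup_left : x ≤ x ⊔ y)))
      (Φ.mapLE (principalFilter_le_principalFilter.2 (le_sup_right : y ≤ x ⊔ y)))
      (Φ.mapLE (principalFilter_le_principalFilter.2 (inf_le_left : x ⊓ y ≤ x)))
      (Φ.mapLE (principalFilter_le_principalFilter.2 (inf_le_right : x ⊓ y ≤ y))) := by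
  let I := {k : ScottOpenFilter L // x ∈ k.toPFilter} × {l : ScottOpenFilter L // y ∈ l.toPFilter}
  have hK' (i : I) : IsPullback
      (Φ.mapLE (toPrincipalOrScottOpen_le.2 (inf_le_left : i.1.1 ⊓ i.2.1 ≤ i.1.1)))
      (Φ.mapLE (toPrincipalOrScottOpen_le.2 (inf_le_right : i.1.1 ⊓ i.2.1 ≤ i.2.1)))
      (Φ.mapLE (toPrincipalOrScottOpen_le.2 (le_sup_left : i.1.1 ≤ i.1.1 ⊔ i.2.1)))
      (Φ.mapLE (toPrincipalOrScottOpen_le.2 (le_sup_right : i.2.1 ≤ i.1.1 ⊔ i.2.1))) :=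
    hK (OrderDual.toDual i.1.1) (OrderDual.toDual i.2.1)
  let inter (i j : I) : I :=
    ⟨⟨i.1.1 ⊓ j.1.1, mem_inf.2 ⟨i.1.2, j.1.2⟩⟩, ⟨i.2.1 ⊓ j.2.1, mem_inf.2 ⟨i.2.2, j.2.2⟩⟩⟩
  have hmem (i : I) : x ⊔ y ∈ (i.1.1 ⊓ i.2.1).toPFilter :=
    mem_inf.2 ⟨Order.PFilter.mem_of_le le_sup_left i.1.2,
      Order.PFilter.mem_of_le le_sup_right i.2.2⟩
  have H : IsLimitOfFamily Φ (fun i : I => (i.1.1 ⊓ i.2.1).toPrincipalOrScottOpen)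
      (principalFilter (x ⊔ y)) fun i => principalFilter_le.2 (hmem i) := by
    refine (hΦ (x ⊔ y)).of_interleaved _ ?_ ?_ ?_
    · exact fun i j => ⟨inter i j,
        toPrincipalOrScottOpen_le.2 (inf_le_inf inf_le_left inf_le_left),
        toPrincipalOrScottOpen_le.2 (inf_le_inf inf_le_right inf_le_right)⟩
    · rintro ⟨m, hm⟩
      -- This set is directed with supremum `x ⊔ y`, so `m` contains some `a ⊔ b`, and `wayAbove a ⊓
      -- wayAbove b` then lies inside `m`.
      let D : Set L := {z | ∃ a b, WayBelow a x ∧ WayBelow b y ∧ a ⊔ b = z}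
      have hne : D.Nonempty := by
        obtain ⟨a, ha⟩ := IsContinuousPoset.nonempty_wayBelow x
        obtain ⟨b, hb⟩ := IsContinuousPoset.nonempty_wayBelow y
        exact ⟨_, a, b, ha, hb, rfl⟩
      have hD : DirectedOn (· ≤ ·) D := by
        rintro _ ⟨a, b, ha, hb, rfl⟩ _ ⟨a', b', ha', hb', rfl⟩
        obtain ⟨c, hc, hac, hac'⟩ := IsContinuousPoset.directedOn_wayBelow x a ha a' ha'
        obtain ⟨d, hd, hbd, hbd'⟩ := IsContinuousPoset.directedOn_wayBelow y b hb b' hb'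
        exact ⟨c ⊔ d, ⟨c, d, hc, hd, rfl⟩, sup_le_sup hac hbd, sup_le_sup hac' hbd'⟩
      have hlub : IsLUB D (x ⊔ y) := by
        obtain ⟨a₀, ha₀⟩ := IsContinuousPoset.nonempty_wayBelow x
        obtain ⟨b₀, hb₀⟩ := IsContinuousPoset.nonempty_wayBelow y
        refine ⟨?_, fun u hu => sup_le ?_ ?_⟩
        · rintro _ ⟨a, b, ha, hb, rfl⟩
          exact sup_le_sup ha.le hb.le
        · exact (IsContinuousPoset.isLUB_wayBelow x).2 fun a ha =>
            le_sup_left.trans (hu ⟨a, b₀, ha, hb₀, rfl⟩)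
        · exact (IsContinuousPoset.isLUB_wayBelow y).2 fun b hb =>
            le_sup_right.trans (hu ⟨a₀, b, ha₀, hb, rfl⟩)
      obtain ⟨_, ⟨a, b, ha, hb, rfl⟩, hab⟩ := m.scottOpen hne hD hlub hm
      refine ⟨⟨⟨wayAbove a, ha⟩, ⟨wayAbove b, hb⟩⟩, fun z hz => ?_⟩
      exact Order.PFilter.mem_of_le
        (sup_le (WayBelow.le (mem_inf.1 hz).1) (WayBelow.le (mem_inf.1 hz).2)) hab
    · exact fun i => ⟨⟨_, hmem i⟩, le_rfl⟩
  have exist : ∀ s : PullbackCone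
      (Φ.mapLE (principalFilter_le_principalFilter.2 (inf_le_left : x ⊓ y ≤ x)))
      (Φ.mapLE (principalFilter_le_principalFilter.2 (inf_le_right : x ⊓ y ≤ y))),
      ∃ t : s.pt ⟶ Φ.obj (principalFilter (x ⊔ y)),
        t ≫ Φ.mapLE (principalFilter_le_principalFilter.2 (le_sup_left : x ≤ x ⊔ y)) = s.fst ∧
        t ≫ Φ.mapLE (principalFilter_le_principalFilter.2 (le_sup_right : y ≤ x ⊔ y)) =
          s.snd := by
    intro s
    have hs (i : I) : s.fst ≫ Φ.mapLE (principalFilter_le.2 i.1.2) ≫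
          Φ.mapLE (toPrincipalOrScottOpen_le.2 (le_sup_left : i.1.1 ≤ i.1.1 ⊔ i.2.1)) =
        s.snd ≫ Φ.mapLE (principalFilter_le.2 i.2.2) ≫
          Φ.mapLE (toPrincipalOrScottOpen_le.2 (le_sup_right : i.2.1 ≤ i.1.1 ⊔ i.2.1)) := by
      have hle : principalFilter (x ⊓ y) ≤ (i.1.1 ⊔ i.2.1).toPrincipalOrScottOpen :=
        principalFilter_le.2 (mem_sup.2 ⟨x, i.1.2, y, i.2.2, le_rfl⟩)
      have := congrArg (· ≫ Φ.mapLE hle) s.condition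
      simpa only [Category.assoc, Functor.mapLE_comp] using this
    choose f hf hf' using fun i : I => (hK' i).exists_lift _ _
      ((Category.assoc _ _ _).trans ((hs i).trans (Category.assoc _ _ _).symm))
    have hle (n i : I) (h₁ : n.1.1 ≤ i.1.1) (h₂ : n.2.1 ≤ i.2.1) :
        f n ≫ Φ.mapLE (toPrincipalOrScottOpen_le.2 (inf_le_inf h₁ h₂)) = f i := by
      refine (hK' i).hom_ext ?_ ?_
      · rw [Category.assoc, Functor.mapLE_comp, hf i,
          ← Functor.mapLE_comp Φ (principalFilter_le_toPrincipalOrScottOpen.2 n.1.2)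
            (toPrincipalOrScottOpen_le.2 h₁), ← Category.assoc, ← hf, Category.assoc,
          Functor.mapLE_comp]
      · rw [Category.assoc, Functor.mapLE_comp, hf' i,
          ← Functor.mapLE_comp Φ (principalFilter_le_toPrincipalOrScottOpen.2 n.2.2)
            (toPrincipalOrScottOpen_le.2 h₂), ← Category.assoc, ← hf', Category.assoc,
          Functor.mapLE_comp]
    obtain ⟨t, ht, -⟩ := H s.pt f fun i j hij => by
      -- The inequality relates the meets `k ⊓ l`, not the pairs, so both lifts are compared with
      -- the lift at the componentwise meet.
      rw [← hle (inter i j) i inf_le_left inf_le_left,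
        ← hle (inter i j) j inf_le_right inf_le_right, Category.assoc, Functor.mapLE_comp]
    refine ⟨t, (hΦ x).hom_ext fun k => ?_, (hΦ y).hom_ext fun l => ?_⟩
    -- The filter `⊤` contains `y`, so every `k` containing `x` occurs as a first component.
    · let i : I := ⟨k, ⟨⊤, Order.PFilter.mem_of_le bot_le bot_mem_top⟩⟩
      have := hf i
      rw [← ht i, Category.assoc, Functor.mapLE_comp] at this
      rw [Category.assoc, Functor.mapLE_comp, this]
    · let i : I := ⟨⟨⊤, Order.PFilter.mem_of_le bot_le bot_mem_top⟩, l⟩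
      have := hf' i
      rw [← ht i, Category.assoc, Functor.mapLE_comp] at this
      rw [Category.assoc, Functor.mapLE_comp, this]
  choose t ht ht' using exist
  refine ⟨⟨(Functor.mapLE_comp Φ _ _).trans (Functor.mapLE_comp Φ _ _).symm⟩,
    ⟨PullbackCone.IsLimit.mk _ t ht ht' fun s u hu hu' => H.hom_ext fun i =>
      (hK' i).hom_ext ?_ ?_⟩⟩
  · have := congrArg (· ≫ Φ.mapLE
      (principalFilter_le_toPrincipalOrScottOpen.2 i.1.2)) (hu.trans (ht s).symm)
    simpa only [Category.assoc, Functor.mapLE_comp] using this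
  · have := congrArg (· ≫ Φ.mapLE
      (principalFilter_le_toPrincipalOrScottOpen.2 i.2.2)) (hu'.trans (ht' s).symm)
    simpa only [Category.assoc, Functor.mapLE_comp] using this

theorem IsKSheaf.isOmegaSheaf [IsStablyContinuousLattice L]
    (h : IsKSheaf (kappaFunctor L ⋙ Φ)) (hΦ : ∀ x, IsScottOpenLimit Φ x) :
    IsOmegaSheaf (lambdaFunctor L ⋙ Φ) where
  subterminal := isSubterminal_of_iso
    (Φ.mapIso (eqToIso (toPrincipalOrScottOpen_top (L := L)))) h.subterminal
  pullback := isPullback_of_isScottOpenLimit h.pullback hΦ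
  limit D hne hD := by
    refine IsLimitOfFamily.nonempty_isLimit (Φ := Φ)
      (A := (Subtype.mono_coe (· ∈ D)).functor.op ⋙ lambdaFunctor L)
      (q := principalFilter (sSup D))
      (h := fun x => principalFilter_le_principalFilter.2 (le_sSup x.unop.2))
      (fun i j hij => ⟨(homOfLE (show j.unop ≤ i.unop from
        principalFilter_le_principalFilter.1 hij)).op⟩) ?_
    refine (hΦ (sSup D)).trans _ ?_ ?_ ?_
    · intro i j
      obtain ⟨c, hc, hic, hjc⟩ := hD _ i.unop.2 _ j.unop.2
      exact ⟨op ⟨c, hc⟩, principalFilter_le_principalFilter.2 hic,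
        principalFilter_le_principalFilter.2 hjc⟩
    -- Scott-openness: a filter containing `sSup D` already contains an element of `D`.
    · rintro ⟨k, hk⟩
      obtain ⟨x, hx, hxk⟩ := k.scottOpen hne hD (isLUB_sSup D) hk
      exact ⟨op ⟨x, hx⟩, principalFilter_le.2 hxk⟩
    · refine fun j => ⟨j, le_rfl, fun T s t hst => congrArg (· ≫ _) ?_⟩
      refine (hΦ j.unop.1).hom_ext fun k => ?_
      exact hst ⟨k.1, Order.PFilter.mem_of_le (le_sSup j.unop.2) k.2⟩ (principalFilter_le.2 k.2)

/-! ### The Kan extensions and the equivalence -/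

instance [HasColimitsOfSize.{w, w} C] (G : Lᵒᵖ ⥤ C) :
    (lambdaFunctor L).HasPointwiseLeftKanExtension G := fun Y =>
  HasColimitsOfShape.has_colimit (CostructuredArrow.proj (lambdaFunctor L) Y ⋙ G)

instance [HasColimitsOfSize.{w, w} C] (G : Lᵒᵖ ⥤ C) :
    (lambdaFunctor L).HasLeftKanExtension G :=
  Functor.LeftExtension.IsPointwiseLeftKanExtension.hasLeftKanExtension
    (Functor.pointwiseLeftKanExtensionIsPointwiseLeftKanExtension _ _)

instance [HasLimitsOfSize.{w, w} C] (F : (ScottOpenFilter L)ᵒᵈᵒᵖ ⥤ C) :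
    (kappaFunctor L).HasPointwiseRightKanExtension F := fun Y =>
  HasLimitsOfShape.has_limit (StructuredArrow.proj Y (kappaFunctor L) ⋙ F)

instance [HasLimitsOfSize.{w, w} C] (F : (ScottOpenFilter L)ᵒᵈᵒᵖ ⥤ C) :
    (kappaFunctor L).HasRightKanExtension F :=
  Functor.RightExtension.IsPointwiseRightKanExtension.hasRightKanExtension
    (Functor.pointwiseRightKanExtensionIsPointwiseRightKanExtension _ _)

/-- The pointwise formula: the comma category of λ over `k` consists of the elements of `k`, and the
invertible unit `η` replaces `G` by the restriction of its extension. -/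
theorem isPrincipalColimit_lan [HasColimitsOfSize.{w, w} C] (G : Lᵒᵖ ⥤ C)
    (k : ScottOpenFilter L) : IsPrincipalColimit ((lambdaFunctor L).lan.obj G) k := by
  let η : G ⟶ lambdaFunctor L ⋙ (lambdaFunctor L).lan.obj G := (lambdaFunctor L).lanUnit.app G
  have : IsIso η := by
    dsimp only [η]
    infer_instance
  have H : IsColimit _ := (lambdaFunctor L).isPointwiseLeftKanExtensionLeftKanExtensionUnit G
    k.toPrincipalOrScottOpen
  intro T f hf
  let s : Cocone (CostructuredArrow.proj (lambdaFunctor L) k.toPrincipalOrScottOpen ⋙ G) :=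
    { pt := T
      ι :=
        { app := fun g => η.app g.left ≫ f ⟨g.left.unop, principalFilter_le.1 (leOfHom g.hom)⟩
          naturality := fun i j g => by
            refine Eq.trans ?_ (Category.comp_id _).symm
            refine (η.naturality_assoc g.left _).trans (congrArg (η.app i.left ≫ ·) ?_)
            exact hf ⟨i.left.unop, principalFilter_le.1 (leOfHom i.hom)⟩
              ⟨j.left.unop, principalFilter_le.1 (leOfHom j.hom)⟩
              (leOfHom ((lambdaFunctor L).map g.left)) } }
  let g (x : {x // x ∈ k.toPFilter}) :
      CostructuredArrow (lambdaFunctor L) k.toPrincipalOrScottOpen :=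
    CostructuredArrow.mk (Y := op x.1) (homOfLE (principalFilter_le.2 x.2))
  refine ⟨H.desc s, fun x => ?_, fun t ht => H.uniq s t fun j => ?_⟩
  · exact (cancel_epi (η.app (op x.1))).1 ((Category.assoc _ _ _).symm.trans (H.fac s (g x)))
  · refine (Category.assoc _ _ _).trans (congrArg (η.app j.left ≫ ·) ?_)
    exact ht ⟨j.left.unop, principalFilter_le.1 (leOfHom j.hom)⟩

theorem isScottOpenLimit_ran [HasLimitsOfSize.{w, w} C] (F : (ScottOpenFilter L)ᵒᵈᵒᵖ ⥤ C)
    (x : L) : IsScottOpenLimit ((kappaFunctor L).ran.obj F) x := by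
  let ε : kappaFunctor L ⋙ (kappaFunctor L).ran.obj F ⟶ F := (kappaFunctor L).ranCounit.app F
  have : IsIso ε := by
    dsimp only [ε]
    infer_instance
  have H : IsLimit _ :=
    (kappaFunctor L).isPointwiseRightKanExtensionRanCounit F (principalFilter x)
  intro T f hf
  let s : Cone (StructuredArrow.proj (principalFilter x) (kappaFunctor L) ⋙ F) :=
    { pt := T
      π :=
        { app := fun g => f ⟨OrderDual.ofDual g.right.unop,
            principalFilter_le.1 (leOfHom g.hom)⟩ ≫ ε.app g.right
          naturality := fun i j g => by
            refine (Category.id_comp _).trans ?_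
            refine Eq.trans ?_ (Category.assoc _ _ _).symm
            refine Eq.trans ?_ (congrArg (f _ ≫ ·) (ε.naturality g.right))
            refine Eq.trans (congrArg (· ≫ ε.app j.right) ?_) (Category.assoc _ _ _)
            exact (hf ⟨OrderDual.ofDual i.right.unop, principalFilter_le.1 (leOfHom i.hom)⟩
              ⟨OrderDual.ofDual j.right.unop, principalFilter_le.1 (leOfHom j.hom)⟩
              (leOfHom ((kappaFunctor L).map g.right))).symm } }
  let g (k : {k : ScottOpenFilter L // x ∈ k.toPFilter}) :
      StructuredArrow (principalFilter x) (kappaFunctor L) :=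
    StructuredArrow.mk (Y := op (OrderDual.toDual k.1)) (homOfLE (principalFilter_le.2 k.2))
  refine ⟨H.lift s, fun k => ?_, fun t ht => H.uniq s t fun j => ?_⟩
  · exact (cancel_mono (ε.app (op (OrderDual.toDual k.1)))).1
      ((Category.assoc _ _ _).trans (H.fac s (g k)))
  · refine (Category.assoc _ _ _).symm.trans (congrArg (· ≫ ε.app j.right) ?_)
    exact ht ⟨OrderDual.ofDual j.right.unop, principalFilter_le.1 (leOfHom j.hom)⟩

theorem IsOmegaSheaf.lambda_lan [HasColimitsOfSize.{w, w} C] {G : Lᵒᵖ ⥤ C} (hG : IsOmegaSheaf G) :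
    IsOmegaSheaf (lambdaFunctor L ⋙ (lambdaFunctor L).lan.obj G) :=
  hG.of_iso (asIso ((lambdaFunctor L).lanUnit.app G))

theorem IsKSheaf.kappa_ran [IsStablyContinuousLattice L] [HasLimitsOfSize.{w, w} C]
    {F : (ScottOpenFilter L)ᵒᵈᵒᵖ ⥤ C}
    (hF : IsKSheaf F) : IsKSheaf (kappaFunctor L ⋙ (kappaFunctor L).ran.obj F) :=
  hF.of_iso (asIso ((kappaFunctor L).ranCounit.app F)).symm

theorem IsOmegaSheaf.isKSheaf_kappaLanLambda [IsStablyContinuousLattice L]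
    [HasColimitsOfSize.{w, w} C]
    (hC : ∀ (J : Type w) [PartialOrder J] [Nonempty J] [IsDirectedOrder J],
      HasExactColimitsOfShape J C)
    {G : Lᵒᵖ ⥤ C} (hG : IsOmegaSheaf G) : IsKSheaf ((kappaLanLambda L C).obj G) :=
  hG.lambda_lan.isKSheaf hC (isPrincipalColimit_lan G)

theorem IsKSheaf.isOmegaSheaf_lambdaRanKappa [IsStablyContinuousLattice L]
    [HasLimitsOfSize.{w, w} C] {F : (ScottOpenFilter L)ᵒᵈᵒᵖ ⥤ C} (hF : IsKSheaf F) :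
    IsOmegaSheaf ((lambdaRanKappa L C).obj F) :=
  hF.kappa_ran.isOmegaSheaf (isScottOpenLimit_ran F)

variable [HasLimitsOfSize.{w, w} C] [HasColimitsOfSize.{w, w} C]

variable (L C) in
/-- The adjunction between `κ^* Lan_λ` and `λ^* Ran_κ`. -/
noncomputable def kappaLanLambdaAdjunction : kappaLanLambda L C ⊣ lambdaRanKappa L C :=
  ((lambdaFunctor L).lanAdjunction C).comp ((kappaFunctor L).ranAdjunction C)

/-- The unit is `lanUnit`, invertible as λ is fully faithful, followed by the restriction of `τ`
along λ. Here `τ` is invertible at Scott-open filters by a triangle identity, hence at principal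
ones, where source and target are limits over Scott-open filters. -/
theorem IsOmegaSheaf.isIso_unit [IsStablyContinuousLattice L] {G : Lᵒᵖ ⥤ C}
    (hG : IsOmegaSheaf G) : IsIso ((kappaLanLambdaAdjunction L C).unit.app G) := by
  let Φ := (lambdaFunctor L).lan.obj G
  let τ : Φ ⟶ (kappaFunctor L).ran.obj (kappaFunctor L ⋙ Φ) :=
    ((kappaFunctor L).ranAdjunction C).unit.app Φ
  have hτ (k : (ScottOpenFilter L)ᵒᵈᵒᵖ) : IsIso (τ.app ((kappaFunctor L).obj k)) := by
    have h : τ.app ((kappaFunctor L).obj k) ≫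
        ((kappaFunctor L).ranCounit.app (kappaFunctor L ⋙ Φ)).app k = 𝟙 _ :=
      (kappaFunctor L).ranCounit_app_app_ranAdjunction_unit_app_app Φ k
    exact IsIso.of_isIso_fac_right h
  have hτ' (x : Lᵒᵖ) : IsIso ((Functor.whiskerLeft (lambdaFunctor L) τ).app x) :=
    IsLimitOfFamily.isIso_app (hG.lambda_lan.isScottOpenLimit x.unop)
      (isScottOpenLimit_ran _ x.unop) τ
  have : IsIso (Functor.whiskerLeft (lambdaFunctor L) τ) := by
    have := hτ'
    exact NatIso.isIso_of_isIso_app _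
  have e : (kappaLanLambdaAdjunction L C).unit.app G =
      (lambdaFunctor L).lanUnit.app G ≫ Functor.whiskerLeft (lambdaFunctor L) τ := by
    simp [kappaLanLambdaAdjunction, τ, Φ]
    rfl
  rw [e]
  exact IsIso.comp_isIso' (f := (lambdaFunctor L).lanUnit.app G) inferInstance this

/-- Dual to `IsOmegaSheaf.isIso_unit`: `τ` is invertible at principal filters, hence at Scott-open
ones, which are colimits over them. -/
theorem IsKSheaf.isIso_counit [IsStablyContinuousLattice L] {F : (ScottOpenFilter L)ᵒᵈᵒᵖ ⥤ C}
    (hF : IsKSheaf F) : IsIso ((kappaLanLambdaAdjunction L C).counit.app F) := by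
  let Φ := (kappaFunctor L).ran.obj F
  let τ : (lambdaFunctor L).lan.obj (lambdaFunctor L ⋙ Φ) ⟶ Φ :=
    ((lambdaFunctor L).lanAdjunction C).counit.app Φ
  have hτ (x : Lᵒᵖ) : IsIso (τ.app ((lambdaFunctor L).obj x)) := by
    have h : ((lambdaFunctor L).lanUnit.app (lambdaFunctor L ⋙ Φ)).app x ≫
        τ.app ((lambdaFunctor L).obj x) = 𝟙 _ :=
      (lambdaFunctor L).lanUnit_app_app_lanAdjunction_counit_app_app Φ x
    exact IsIso.of_isIso_fac_left h
  have hτ' (k : (ScottOpenFilter L)ᵒᵈᵒᵖ) :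
      IsIso ((Functor.whiskerLeft (kappaFunctor L) τ).app k) :=
    IsColimitOfFamily.isIso_app (isPrincipalColimit_lan _ (OrderDual.ofDual k.unop))
      (hF.kappa_ran.isPrincipalColimit (OrderDual.ofDual k.unop)) τ
  have : IsIso (Functor.whiskerLeft (kappaFunctor L) τ) := by
    have := hτ'
    exact NatIso.isIso_of_isIso_app _
  have e : (kappaLanLambdaAdjunction L C).counit.app F =
      Functor.whiskerLeft (kappaFunctor L) τ ≫ (kappaFunctor L).ranCounit.app F := by
    simp [kappaLanLambdaAdjunction, τ, Φ]
    rfl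
  rw [e]
  exact IsIso.comp_isIso' (h := (kappaFunctor L).ranCounit.app F) this inferInstance

end Kan

theorem mainTheorem4 {C : Type u} [Category.{v} C] [Regular C]
    [HasLimitsOfSize.{w, w} C] [HasColimitsOfSize.{w, w} C]
    (hC : ∀ (J : Type w) [PartialOrder J] [Nonempty J] [IsDirectedOrder J],
      HasExactColimitsOfShape J C)
    (L : Type w) [CompleteLattice L] [IsStablyContinuousLattice L] :
    ∃ e : KSh (ScottOpenFilter L)ᵒᵈ C ≌ OmegaSh L C,
      Nonempty (e.functor ⋙ (omegaSheafProperty L C).ι ≅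
        (kSheafProperty (ScottOpenFilter L)ᵒᵈ C).ι ⋙ lambdaRanKappa L C) ∧
      Nonempty (e.inverse ⋙ (kSheafProperty (ScottOpenFilter L)ᵒᵈ C).ι ≅
        (omegaSheafProperty L C).ι ⋙ kappaLanLambda L C) := by
  let iK := (kSheafProperty (ScottOpenFilter L)ᵒᵈ C).ι
  let iΩ := (omegaSheafProperty L C).ι
  let Λ : OmegaSh L C ⥤ KSh (ScottOpenFilter L)ᵒᵈ C :=
    ObjectProperty.lift _ (iΩ ⋙ kappaLanLambda L C)
      fun G => G.property.isKSheaf_kappaLanLambda hC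
  let R : KSh (ScottOpenFilter L)ᵒᵈ C ⥤ OmegaSh L C :=
    ObjectProperty.lift _ (iK ⋙ lambdaRanKappa L C)
      fun F => F.property.isOmegaSheaf_lambdaRanKappa
  let eΛ : iΩ ⋙ kappaLanLambda L C ≅ Λ ⋙ iK := Iso.refl _
  let eR : iK ⋙ lambdaRanKappa L C ≅ R ⋙ iΩ := Iso.refl _
  let adj : Λ ⊣ R := (kappaLanLambdaAdjunction L C).restrictFullyFaithful
    (ObjectProperty.fullyFaithfulι _) (ObjectProperty.fullyFaithfulι _) eΛ eR
  have hunit (G : OmegaSh L C) : IsIso (adj.unit.app G) := by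
    have := G.property.isIso_unit
    have h : iΩ.map (adj.unit.app G) = _ :=
      (kappaLanLambdaAdjunction L C).map_restrictFullyFaithful_unit_app
        (ObjectProperty.fullyFaithfulι _) (ObjectProperty.fullyFaithfulι _) eΛ eR G
    have : IsIso (iΩ.map (adj.unit.app G)) := by
      rw [h]
      dsimp only [iΩ, ObjectProperty.ι_obj]
      infer_instance
    exact isIso_of_reflects_iso _ iΩ
  have hcounit (F : KSh (ScottOpenFilter L)ᵒᵈ C) : IsIso (adj.counit.app F) := by
    have := F.property.isIso_counit
    have h : iK.map (adj.counit.app F) = _ :=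
      (kappaLanLambdaAdjunction L C).map_restrictFullyFaithful_counit_app
        (ObjectProperty.fullyFaithfulι _) (ObjectProperty.fullyFaithfulι _) eΛ eR F
    have : IsIso (iK.map (adj.counit.app F)) := by
      rw [h]
      dsimp only [iK, ObjectProperty.ι_obj]
      infer_instance
    exact isIso_of_reflects_iso _ iK
  -- The left adjoint starts at the Ω-sheaves, hence `symm`.
  exact ⟨adj.toEquivalence.symm, ⟨eR.symm⟩, ⟨eΛ.symm⟩⟩
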